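/- **Setting.** Let $\sigma:\mathbb R^n\times\mathbb R^m\to\mathbb R^{n\times r}$ be bounded and Lipschitz continuous, with $\sigma(x,\cdot)$ $\mathbb Z^m$-periodic for each $x$. Let $\tau:\mathbb R^m\to\mathbb R^{m\times r}$ be locally Lipschitz continuous and $\mathbb Z^m$-periodic, and suppose that for some $\theta>0$ $$|\tau(y)^T\xi|^2\ \ge\ \theta|\xi|^2\qquad\text{for all } y,\xi\in\mathbb R^m .$$ For $(\bar x,\bar p)\in\mathbb R^n\times\mathbb R^n$ let $\bar H(\bar x,\bar p)$ be the effective Hamiltonian of the subcritical case. It is the unique real constant $c$ (existence and uniqueness are part of the statement) for which the cell problem $$c-2\big(\tau(y)\sigma(\bar x,y)^T\bar p\big)\cdot Dw(y)-|\tau(y)^TDw(y)|^2-|\sigma(\bar x,y)^T\bar p|^2=0\quad\text{in }\mathbb R^m$$ has a continuous $\mathbb Z^m$-periodic viscosity solution $w$. **Proposition.** (i) For all $\bar x,\bar p\in\mathbb R^n$, $$\bar H(\bar x,\bar p)=\lim_{\delta\to0^+}\ \sup_{\beta(\cdot)}\ \delta\int_0^{+\infty}\big(|\sigma(\bar x,y(t))^T\bar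 p|^2-|\beta(t)|^2\big)e^{-\delta t}\,dt ,$$ uniformly with respect to the initial position $y\in\mathbb R^m$. Here $\beta(\cdot)$ varies over the measurable functions $[0,\infty)\to\mathbb R^r$, and $y(\cdot)$ is a trajectory of $$\dot y(t)=2\tau(y(t))\sigma(\bar x,y(t))^T\bar p-2\tau(y(t))\beta(t)\quad (t>0),\qquad y(0)=y .$$ Trajectories are understood in the integral (Carathéodory) sense. Controls without a trajectory are not admitted, and the integral is $-\infty$ if $\int_0^\infty|\beta(t)|^2e^{-\delta t}\,dt=\infty$. (ii) If $\tau(y)\sigma(x,y)^T=0$ for all $x\in\mathbb R^n$, $y\in\mathbb R^m$, then for all $\bar x,\bar p\in\mathbb R^n$ $$\bar H(\bar x,\bar p)=\max_{y\in\mathbb R^m}|\sigma(\bar x,y)^T\bar p|^2 .$$ (iii) If $n=m=r=1$ and $\sigma\ge0$, then for all $\bar x,\bar p\in\mathbb R$ $$\bar H(\bar x,\bar p)=\left(\int_0^1\frac{\sigma(\bar x,y)}{\tau(y)}\,dy\right)^{2}\left(\int_0^1\frac{1}{\tau(y)}\,dy\right)^{-2}\bar p^{\,2}.$$ -/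

import Mathlib

open MeasureTheory Filter Topology Set
open scoped Matrix

noncomputable section

/-- Euclidean space `ℝᵏ`. -/
abbrev Eucl (k : ℕ) : Type := EuclideanSpace ℝ (Fin k)

/-- `A ξ` for a `k × l` matrix `A` and a vector `ξ` of `ℝˡ`, as a vector of `ℝᵏ`. -/
def matAct {k l : ℕ} (A : Matrix (Fin k) (Fin l) ℝ) (ξ : Eucl l) : Eucl k :=
  WithLp.toLp 2 (A *ᵥ ξ.ofLp)

/-- `ℤᵐ`-periodicity of a function on `ℝᵐ`. -/
def ZPeriodic {m : ℕ} {α : Type*} (f : Eucl m → α) : Prop :=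
  ∀ (y : Eucl m) (k : Fin m → ℤ), f (y + WithLp.toLp 2 (fun j => (k j : ℝ))) = f y

/-- Continuous viscosity solutions on `ℝᵐ` of the first order equation `F(y, Dw(y)) = 0`. -/
def IsViscositySolution {m : ℕ} (F : Eucl m → Eucl m → ℝ) (w : Eucl m → ℝ) : Prop :=
  Continuous w ∧
  (∀ φ : Eucl m → ℝ, ContDiff ℝ 1 φ → ∀ y : Eucl m,
    IsLocalMax (fun z => w z - φ z) y → F y (gradient φ y) ≤ 0) ∧
  (∀ φ : Eucl m → ℝ, ContDiff ℝ 1 φ → ∀ y : Eucl m,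
    IsLocalMin (fun z => w z - φ z) y → 0 ≤ F y (gradient φ y))

/-- The cell problem at `(x, p)` with constant `c` has a periodic viscosity solution `w`:
`c - 2 (τ(y) σ(x,y)ᵀ p) · Dw(y) - |τ(y)ᵀ Dw(y)|² - |σ(x,y)ᵀ p|² = 0` in `ℝᵐ`. -/
def CellProblemSolvable {n m r : ℕ} (σ : Eucl n → Eucl m → Matrix (Fin n) (Fin r) ℝ)
    (τ : Eucl m → Matrix (Fin m) (Fin r) ℝ) (x p : Eucl n) (c : ℝ) : Prop :=
  ∃ w : Eucl m → ℝ, ZPeriodic w ∧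
    IsViscositySolution
      (fun y q => c - 2 * inner ℝ (matAct (τ y) (matAct (σ x y)ᵀ p)) q
        - ‖matAct (τ y)ᵀ q‖ ^ 2 - ‖matAct (σ x y)ᵀ p‖ ^ 2) w

/-- The effective Hamiltonian at `(x, p)`: the constant for which the cell problem
has a periodic viscosity solution. -/
def effectiveHamiltonian {n m r : ℕ} (σ : Eucl n → Eucl m → Matrix (Fin n) (Fin r) ℝ)
    (τ : Eucl m → Matrix (Fin m) (Fin r) ℝ) (x p : Eucl n) : ℝ :=
  Classical.epsilon (CellProblemSolvable σ τ x p)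

/-- Right-hand side `2 τ(y) σ(x,y)ᵀ p - 2 τ(y) b` of the control system. -/
def controlField {n m r : ℕ} (σ : Eucl n → Eucl m → Matrix (Fin n) (Fin r) ℝ)
    (τ : Eucl m → Matrix (Fin m) (Fin r) ℝ) (x p : Eucl n) (y : Eucl m) (b : Eucl r) : Eucl m :=
  (2 : ℝ) • matAct (τ y) (matAct (σ x y)ᵀ p) - (2 : ℝ) • matAct (τ y) b

/-- `y` is a (Carathéodory) trajectory on `[0, ∞)` of the control system for the control `β`,
starting from `y₀`. -/
def IsTrajectory {n m r : ℕ} (σ : Eucl n → Eucl m → Matrix (Fin n) (Fin r) ℝ)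
    (τ : Eucl m → Matrix (Fin m) (Fin r) ℝ) (x p : Eucl n) (y₀ : Eucl m)
    (β : ℝ → Eucl r) (y : ℝ → Eucl m) : Prop :=
  ∀ t : ℝ, 0 ≤ t →
    IntervalIntegrable (fun s => controlField σ τ x p (y s) (β s)) volume 0 t ∧
    y t = y₀ + ∫ s in (0 : ℝ)..t, controlField σ τ x p (y s) (β s)

/-- `δ ∫₀^∞ (|σ(x,y(t))ᵀ p|² - |β(t)|²) e^{-δt} dt`, which is `-∞` when the control term is
not integrable (the other term is bounded in all uses). -/
def discountedPayoff {n m r : ℕ} (σ : Eucl n → Eucl m → Matrix (Fin n) (Fin r) ℝ)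
    (x p : Eucl n) (δ : ℝ) (β : ℝ → Eucl r) (y : ℝ → Eucl m) : EReal :=
  (δ : EReal) *
    (((∫⁻ t in Ioi (0 : ℝ),
        ENNReal.ofReal (‖matAct (σ x (y t))ᵀ p‖ ^ 2 * Real.exp (-δ * t)) : ENNReal) : EReal)
      - ((∫⁻ t in Ioi (0 : ℝ),
        ENNReal.ofReal (‖β t‖ ^ 2 * Real.exp (-δ * t)) : ENNReal) : EReal))

/-- Supremum of the discounted payoff over the measurable controls `β` and the corresponding
trajectories that start from `y₀`. -/
def discountedValue {n m r : ℕ} (σ : Eucl n → Eucl m → Matrix (Fin n) (Fin r) ℝ)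
    (τ : Eucl m → Matrix (Fin m) (Fin r) ℝ) (x p : Eucl n) (δ : ℝ) (y₀ : Eucl m) : EReal :=
  ⨆ (β : ℝ → Eucl r) (y : ℝ → Eucl m)
    (_ : Measurable β ∧ IsTrajectory σ τ x p y₀ β y), discountedPayoff σ x p δ β y

end

set_option linter.unusedSectionVars false

/-! Freeze `(x, p)`, write `A = τ` and `s = σᵀp`, and use the control `α = s - β`. The dynamics
become `y' = 2 A(y) α` and the running payoff `|s|² - |β|²` becomes `2⟨s, α⟩ - |α|²`. Completing the
square in `α` shows that the Hamiltonian of this problem is `|Aᵀq + s|²`, so the cell problem reads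
`|AᵀDw + s|² = c`. Nondegeneracy of `τ` gives `A` a bounded right inverse `R`. Hence nearby points
can be joined at a controlled cost, and the Hamiltonian is coercive in `q`.

Existence comes from an Euler scheme of step `h` with discount factor `1 - h²`, that is, with
discount rate `h` per unit time. Its fixed point `u` is Lipschitz uniformly in `h`
(`scheme_lipschitz`), because two nearby points can be steered to the same endpoint. With `c = h
u(0)` and `w = u - u(0)`, the undiscounted equation then holds up to `O(h²)` per step
(`exists_isSchemeSolution`). Limits as `h → 0` are viscosity solutions (`exists_isCellSolution`),
and doubling the variables shows that `c` is unique (`IsCellSolution.le`).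

For (i), the limit `w` is only a viscosity solution, so it is not differentiated along trajectories.
The scheme solutions themselves serve as verification functions. Replacing a path on each step by
one Euler step with the mean control, and then letting `h → 0`, bounds the reward on `[0, T]` by `cT
+ 2K` (`IsPath.integral_reward_le`). Conversely, a chain of nearly optimal Euler steps is joined
into a polygon, and `R` corrects the control so that the polygon is an exact trajectory
(`exists_isPath_le_integral_reward`). Since `e^{-δt}` is an average of indicators of `[0, T]`, both
bounds pass to the discounted payoff with an error `O(δ)` independent of the starting point.

For (ii), the cross term of the Hamiltonian vanishes, so `|s|²` is at most the Hamiltonian whatever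
the gradient, with equality at zero gradient. For (iii), the equation is solved explicitly by
requiring `τ w' + σp` to be constant. -/

/-- The data of a controlled system `y' = 2 A(y) α` on `E` with running reward
`2 ⟨s(y), α⟩ - ‖α‖²`, periodic with respect to a cocompact group of periods. -/
structure PeriodicSystem (E G : Type*) [NormedAddCommGroup E] [InnerProductSpace ℝ E]
    [NormedAddCommGroup G] [InnerProductSpace ℝ G] where
  /-- the control matrix -/
  A : E → G →L[ℝ] E
  /-- the drift in the space of controls -/
  s : E → G
  /-- a right inverse of the control matrix -/
  R : E → E →L[ℝ] G
  /-- the group of periods -/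
  P : AddSubgroup E
  /-- a common bound for all the data -/
  M : ℝ
  one_le_M : 1 ≤ M
  norm_A_le : ∀ y, ‖A y‖ ≤ M
  norm_s_le : ∀ y, ‖s y‖ ≤ M
  norm_R_le : ∀ y, ‖R y‖ ≤ M
  A_lip : ∀ x y, ‖A x - A y‖ ≤ M * ‖x - y‖
  s_lip : ∀ x y, ‖s x - s y‖ ≤ M * ‖x - y‖
  continuous_R : Continuous R
  A_R : ∀ y v, A y (R y v) = v
  A_add : ∀ y, ∀ k ∈ P, A (y + k) = A y
  s_add : ∀ y, ∀ k ∈ P, s (y + k) = s y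
  cover : ∀ y, ∃ k ∈ P, ‖y + k‖ ≤ M

/-! ### Propagating increment bounds along segments -/

theorem sub_le_nsmul_of_forall_norm_sub_le {E : Type*} [NormedAddCommGroup E] [NormedSpace ℝ E]
    {f : E → ℝ} {r b : ℝ} (hf : ∀ x z, ‖z - x‖ ≤ r → f z - f x ≤ b) (N : ℕ) :
    ∀ x z, ‖z - x‖ ≤ N * r → f z - f x ≤ N * b := by
  induction N with
  | zero =>
    intro x z h
    have : z - x = 0 := norm_le_zero_iff.1 (by simpa using h)
    rw [sub_eq_zero.1 this]; simp
  | succ N ih =>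
    intro x z h
    have hN : (0 : ℝ) < N + 1 := by positivity
    set y : E := x + ((N : ℝ) / (N + 1)) • (z - x) with hy
    have h1 : ‖y - x‖ ≤ N * r := by
      rw [hy, add_sub_cancel_left, norm_smul, Real.norm_of_nonneg (by positivity)]
      push_cast at h
      calc (N : ℝ) / (N + 1) * ‖z - x‖ ≤ N / (N + 1) * ((N + 1) * r) := by gcongr
        _ = N * r := by field_simp
    have h2 : ‖z - y‖ ≤ r := by
      have : z - y = (1 / ((N : ℝ) + 1)) • (z - x) := by
        have h3 : (1 : ℝ) / (N + 1) = 1 - N / (N + 1) := by field_simp; ring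
        rw [h3, hy, sub_smul, one_smul]; abel
      rw [this, norm_smul, Real.norm_of_nonneg (by positivity)]
      push_cast at h
      calc (1 : ℝ) / (N + 1) * ‖z - x‖ ≤ 1 / (N + 1) * ((N + 1) * r) := by gcongr
        _ = r := by field_simp
    have := ih x y h1
    have := hf y z h2
    push_cast; linarith

/-- Short-range estimates add up along a segment without loss in the constant. -/
theorem sub_le_of_forall_norm_sub_le_local {E : Type*} [NormedAddCommGroup E] [NormedSpace ℝ E]
    {f : E → ℝ} {h K : ℝ} (hh : 0 < h)
    (hf : ∀ x z, ‖z - x‖ ≤ h → f z - f x ≤ K * ‖z - x‖) (hK : 0 ≤ K) (x z : E) :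
    f z - f x ≤ K * ‖z - x‖ := by
  obtain ⟨N, hN⟩ := exists_nat_gt (‖z - x‖ / h)
  have hN0 : (0 : ℝ) < N := lt_of_le_of_lt (by positivity) hN
  have h1 : ‖z - x‖ / N ≤ h := by
    rw [div_lt_iff₀ hh] at hN
    rw [div_le_iff₀ hN0]; linarith
  have := sub_le_nsmul_of_forall_norm_sub_le (f := f) (r := ‖z - x‖ / N) (b := K * (‖z - x‖ / N))
    (fun a b hab => (hf a b (hab.trans h1)).trans (by gcongr)) N x z (by field_simp; rfl)
  calc _ ≤ _ := this
    _ = _ := by field_simp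

/-! ### The discounted Euler scheme and its fixed point -/

namespace PeriodicSystem

variable {E G : Type*} [NormedAddCommGroup E] [InnerProductSpace ℝ E]
    [NormedAddCommGroup G] [InnerProductSpace ℝ G] (S : PeriodicSystem E G)

/-- The running reward. -/
noncomputable def reward (y : E) (α : G) : ℝ := 2 * inner ℝ (S.s y) α - ‖α‖ ^ 2

/-- The point reached from `x` in one Euler step of length `h`. -/
noncomputable def euler (h : ℝ) (x : E) (α : G) : E := x + (2 * h) • S.A x α

theorem M_pos : 0 < S.M := lt_of_lt_of_le one_pos S.one_le_M

theorem norm_A_apply_le (x : E) (α : G) : ‖S.A x α‖ ≤ S.M * ‖α‖ :=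
  (S.A x).le_of_opNorm_le (S.norm_A_le x) α

theorem norm_R_apply_le (x v : E) : ‖S.R x v‖ ≤ S.M * ‖v‖ :=
  (S.R x).le_of_opNorm_le (S.norm_R_le x) v

theorem norm_A_sub_apply_le (x y : E) (α : G) :
    ‖S.A x α - S.A y α‖ ≤ S.M * ‖x - y‖ * ‖α‖ :=
  (S.A x - S.A y).le_of_opNorm_le (S.A_lip x y) α

theorem abs_inner_s_le (x : E) (α : G) : |inner ℝ (S.s x) α| ≤ S.M * ‖α‖ :=
  (abs_real_inner_le_norm _ _).trans (by gcongr; exact S.norm_s_le x)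

theorem reward_le (x : E) (α : G) : S.reward x α ≤ S.M ^ 2 := by
  have := (abs_le.1 (S.abs_inner_s_le x α)).2
  unfold reward
  nlinarith [sq_nonneg (S.M - ‖α‖)]

theorem le_reward (x : E) (α : G) : -(2 * S.M * ‖α‖ + ‖α‖ ^ 2) ≤ S.reward x α := by
  have := (abs_le.1 (S.abs_inner_s_le x α)).1
  unfold reward
  linarith

theorem reward_zero (x : E) : S.reward x 0 = 0 := by simp [reward]

/-- The right side involves only `‖α‖` and `‖α' - α‖`: in the applications `α` is bounded and `α'`
is a correction of it. -/
theorem reward_sub_le (x x' : E) (α α' : G) :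
    S.reward x α - S.reward x' α' ≤
      2 * S.M * ‖x - x'‖ * ‖α‖ + ‖α' - α‖ * (2 * S.M + 2 * ‖α‖ + ‖α' - α‖) := by
  have e : S.reward x α - S.reward x' α' = 2 * inner ℝ (S.s x - S.s x') α
      - 2 * inner ℝ (S.s x') (α' - α) + (‖α'‖ ^ 2 - ‖α‖ ^ 2) := by
    simp only [reward, inner_sub_left, inner_sub_right]; ring
  have h1 : inner ℝ (S.s x - S.s x') α ≤ S.M * ‖x - x'‖ * ‖α‖ :=
    (real_inner_le_norm _ _).trans (by gcongr; exact S.s_lip x x')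
  have h2 := (abs_le.1 (S.abs_inner_s_le x' (α' - α))).1
  have h3 : ‖α'‖ ≤ ‖α‖ + ‖α' - α‖ := by
    simpa using norm_add_le α (α' - α)
  have h4 : ‖α'‖ ^ 2 ≤ (‖α‖ + ‖α' - α‖) ^ 2 := by gcongr
  rw [e]; nlinarith

/-- Value iteration for the discounted Euler scheme. -/
noncomputable def iter (h : ℝ) : ℕ → E → ℝ
  | 0 => fun _ => 0
  | n + 1 => fun x => ⨆ α : G, ((1 - h ^ 2) * iter h n (S.euler h x α) + h * S.reward x α)

section scheme

variable {h : ℝ} (h0 : 0 < h) (h1 : h ≤ 1)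
include h0 h1

theorem iterStep_le {f : E → ℝ} (hf : ∀ x, f x ≤ S.M ^ 2 / h) (x : E) (α : G) :
    (1 - h ^ 2) * f (S.euler h x α) + h * S.reward x α ≤ S.M ^ 2 / h := by
  have : 0 ≤ 1 - h ^ 2 := by nlinarith
  calc _ ≤ (1 - h ^ 2) * (S.M ^ 2 / h) + h * S.M ^ 2 := by
        gcongr
        · exact hf _
        · exact S.reward_le x α
    _ = S.M ^ 2 / h := by field_simp; ring

theorem iter_le (n : ℕ) (x : E) : S.iter h n x ≤ S.M ^ 2 / h := by
  induction n generalizing x with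
  | zero => simp only [iter]; positivity
  | succ n ih => exact ciSup_le fun α => S.iterStep_le h0 h1 ih x α

theorem le_iter_succ (n : ℕ) (x : E) (α : G) :
    (1 - h ^ 2) * S.iter h n (S.euler h x α) + h * S.reward x α ≤ S.iter h (n + 1) x :=
  le_ciSup (f := fun α : G => (1 - h ^ 2) * S.iter h n (S.euler h x α) + h * S.reward x α)
    ⟨S.M ^ 2 / h, by rintro _ ⟨α, rfl⟩; exact S.iterStep_le h0 h1 (S.iter_le h0 h1 n) x α⟩ α

theorem iter_add (n : ℕ) (x : E) {k : E} (hk : k ∈ S.P) : S.iter h n (x + k) = S.iter h n x := by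
  induction n generalizing x with
  | zero => rfl
  | succ n ih =>
    simp only [iter]
    congr 1
    ext α
    have : S.euler h (x + k) α = S.euler h x α + k := by
      simp only [euler, S.A_add x k hk]; abel
    rw [this, ih]
    simp only [reward, S.s_add x k hk]

/-- The fixed point is the supremum of the value iterates. Suprema over `n` and over `α` can be
exchanged, so neither contraction nor continuity enters. Attainment of the supremum over controls is
not established, hence the tolerance `η`. -/
theorem exists_discounted_fixedPoint : ∃ u : E → ℝ,
    (∀ x, 0 ≤ u x) ∧ (∀ x, u x ≤ S.M ^ 2 / h) ∧ (∀ x, ∀ k ∈ S.P, u (x + k) = u x) ∧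
    (∀ x α, (1 - h ^ 2) * u (S.euler h x α) + h * S.reward x α ≤ u x) ∧
    (∀ x, ∀ η > 0, ∃ α, u x - η ≤ (1 - h ^ 2) * u (S.euler h x α) + h * S.reward x α) := by
  have hl : 0 ≤ 1 - h ^ 2 := by nlinarith
  have hb : ∀ x, BddAbove (range fun n => S.iter h n x) := fun x =>
    ⟨S.M ^ 2 / h, by rintro _ ⟨n, rfl⟩; exact S.iter_le h0 h1 n x⟩
  refine ⟨fun x => ⨆ n, S.iter h n x, fun x => le_ciSup (hb x) 0,
    fun x => ciSup_le fun n => S.iter_le h0 h1 n x,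
    fun x k hk => by simp only [S.iter_add h0 h1 _ x hk], fun x α => ?_, fun x η hη => ?_⟩
  · rw [Real.mul_iSup_of_nonneg hl, ← le_sub_iff_add_le]
    refine ciSup_le fun n => ?_
    rw [le_sub_iff_add_le]
    exact (S.le_iter_succ h0 h1 n x α).trans (le_ciSup (hb x) (n + 1))
  · obtain ⟨n, hn⟩ := exists_lt_of_lt_ciSup (show (⨆ n, S.iter h n x) - η / 2 < _ by
      exact sub_lt_self _ (by positivity))
    cases n with
    | zero =>
      -- The zeroth iterate is within `η / 2` of the supremum, so the value at `x` is below `η / 2`.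
      -- The null control, whose reward is zero, is then good enough.
      refine ⟨0, ?_⟩
      rw [reward_zero, mul_zero, add_zero]
      have h3 : 0 ≤ ⨆ n, S.iter h n (S.euler h x 0) := le_ciSup (hb _) 0
      have : (⨆ n, S.iter h n x) - η / 2 < 0 := hn
      have := mul_nonneg hl h3
      linarith
    | succ n =>
      obtain ⟨α, hα⟩ := exists_lt_of_lt_ciSup
        (show S.iter h (n + 1) x - η / 2 < ⨆ α : G,
          ((1 - h ^ 2) * S.iter h n (S.euler h x α) + h * S.reward x α) by
          exact sub_lt_self _ (by positivity))
      refine ⟨α, ?_⟩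
      have : (1 - h ^ 2) * S.iter h n (S.euler h x α) ≤
          (1 - h ^ 2) * ⨆ n, S.iter h n (S.euler h x α) :=
        mul_le_mul_of_nonneg_left (le_ciSup (hb _) n) hl
      linarith

end scheme

end PeriodicSystem

/-! ### Lipschitz bounds uniform in the step -/

namespace PeriodicSystem

variable {E G : Type*} [NormedAddCommGroup E] [InnerProductSpace ℝ E]
    [NormedAddCommGroup G] [InnerProductSpace ℝ G] (S : PeriodicSystem E G)

/-- Approximate solutions, with step `h` and error `K h²` per step, of the ergodic equation
for the Euler scheme. -/
structure IsSchemeSolution (S : PeriodicSystem E G) (h K c : ℝ) (w : E → ℝ) : Prop where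
  nonneg : 0 ≤ c
  le : c ≤ K
  add_period : ∀ x, ∀ k ∈ S.P, w (x + k) = w x
  lip : ∀ x z, w z - w x ≤ K * ‖z - x‖
  abs_le : ∀ x, |w x| ≤ K
  super : ∀ x α, w (S.euler h x α) + h * (S.reward x α - c) - K * h ^ 2 ≤ w x
  sub : ∀ x, ∃ α, ‖α‖ ≤ K ∧ w x ≤ w (S.euler h x α) + h * (S.reward x α - c) + K * h ^ 2

theorem euler_R {h : ℝ} (h0 : 0 < h) (x z : E) :
    S.euler h x ((1 / (2 * h)) • S.R x (z - x)) = z := by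
  rw [euler, map_smul, S.A_R, smul_smul]
  field_simp
  simp

theorem norm_euler_sub {h : ℝ} (h0 : 0 < h) (x : E) (α : G) :
    ‖S.euler h x α - x‖ ≤ 2 * h * (S.M * ‖α‖) := by
  rw [euler, add_sub_cancel_left, norm_smul, Real.norm_of_nonneg (by positivity)]
  gcongr
  exact S.norm_A_apply_le x α

variable {h : ℝ} {u : E → ℝ} (h0 : 0 < h) (h1 : h ≤ 1) (hu0 : ∀ x, 0 ≤ u x)
  (huM : ∀ x, u x ≤ S.M ^ 2 / h)
  (hup : ∀ x α, (1 - h ^ 2) * u (S.euler h x α) + h * S.reward x α ≤ u x)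

-- Through `R`, a control of norm at most `M / 2` steers `x` in one step to any point at distance at
-- most `h`, at a cost of order `h`. The extra `h` on the right is the price of rounding the number
-- of steps up. It disappears in `scheme_lipschitz`, once nearly optimal controls are known to be
-- bounded.
include h0 huM hup in
theorem rough_lipschitz (x z : E) : u z - u x ≤ 3 * S.M ^ 2 * (‖z - x‖ + h) := by
  have hM := S.M_pos
  have step : ∀ x z : E, ‖z - x‖ ≤ h → u z - u x ≤ 3 * S.M ^ 2 * h := by
    intro x z hz
    have h2 := hup x ((1 / (2 * h)) • S.R x (z - x))
    rw [S.euler_R h0] at h2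
    have ha : ‖(1 / (2 * h)) • S.R x (z - x)‖ ≤ S.M / 2 := by
      rw [norm_smul, Real.norm_of_nonneg (by positivity)]
      calc 1 / (2 * h) * ‖S.R x (z - x)‖ ≤ 1 / (2 * h) * (S.M * h) := by
            gcongr
            exact (S.norm_R_apply_le x _).trans (by gcongr)
        _ = S.M / 2 := by field_simp
    set α := (1 / (2 * h)) • S.R x (z - x)
    have h3 := S.le_reward x α
    have h4 : 2 * S.M * ‖α‖ + ‖α‖ ^ 2 ≤ 2 * S.M * (S.M / 2) + (S.M / 2) ^ 2 := by gcongr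
    have h5 : h ^ 2 * u z ≤ h * S.M ^ 2 := by
      calc h ^ 2 * u z ≤ h ^ 2 * (S.M ^ 2 / h) := by gcongr; exact huM z
        _ = h * S.M ^ 2 := by field_simp
    have h6 : h * (-(2 * S.M * (S.M / 2) + (S.M / 2) ^ 2)) ≤ h * S.reward x α := by
      gcongr; linarith
    nlinarith [mul_pos h0 (pow_pos hM 2)]
  have h2 := sub_le_nsmul_of_forall_norm_sub_le step (⌈‖z - x‖ / h⌉₊) x z (by
    have := Nat.le_ceil (‖z - x‖ / h)
    rwa [div_le_iff₀ h0] at this)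
  have h3 := (Nat.ceil_lt_add_one (show 0 ≤ ‖z - x‖ / h by positivity)).le
  calc u z - u x ≤ _ := h2
    _ ≤ (‖z - x‖ / h + 1) * (3 * S.M ^ 2 * h) := by gcongr
    _ = _ := by field_simp

/-- Bound for nearly optimal controls. -/
noncomputable def controlBound : ℝ := 2 + 3 * S.M ^ 2 + (2 * S.M + 6 * S.M ^ 3)

theorem one_le_controlBound : 1 ≤ S.controlBound := by
  have hM := S.M_pos
  unfold controlBound
  have : 0 < 3 * S.M ^ 2 + (2 * S.M + 6 * S.M ^ 3) := by positivity
  linarith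

-- The reward contains the loss `h‖α‖²`, whereas by `rough_lipschitz` the gain of `u` over the
-- displacement `2hM‖α‖` is only of order `h(1 + ‖α‖)`. Dividing by `h` gives a bound free of `h`.
include h0 hu0 huM hup in
theorem norm_control_le {x : E} {α : G}
    (hα : u x - h ≤ (1 - h ^ 2) * u (S.euler h x α) + h * S.reward x α) :
    ‖α‖ ≤ S.controlBound := by
  have hM := S.M_pos
  have h2 := S.rough_lipschitz h0 huM hup x (S.euler h x α)
  have h3 := S.norm_euler_sub h0 x α
  have h4 : 0 ≤ h ^ 2 * u (S.euler h x α) := mul_nonneg (by positivity) (hu0 _)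
  have h5 : S.reward x α ≤ 2 * (S.M * ‖α‖) - ‖α‖ ^ 2 := by
    have := (abs_le.1 (S.abs_inner_s_le x α)).2
    unfold reward; linarith
  have h6 : 3 * S.M ^ 2 * (‖S.euler h x α - x‖ + h) ≤
      3 * S.M ^ 2 * (2 * h * (S.M * ‖α‖) + h) := by gcongr
  have h7 : h * S.reward x α ≤ h * (2 * (S.M * ‖α‖) - ‖α‖ ^ 2) := by gcongr
  have h8 : h * ‖α‖ ^ 2 ≤ h * (1 + 3 * S.M ^ 2 + (2 * S.M + 6 * S.M ^ 3) * ‖α‖) := by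
    nlinarith
  have h9 := le_of_mul_le_mul_left h8 h0
  by_contra hcon
  push Not at hcon
  have h10 := S.one_le_controlBound
  have h11 : ‖α‖ * S.controlBound < ‖α‖ ^ 2 := by nlinarith
  have h12 : 0 < 1 + 3 * S.M ^ 2 := by positivity
  unfold controlBound at *
  nlinarith

/-- The ratio `‖α' - α‖ h / ‖x - x'‖` when `α'` steers `x'` to the point to which `α` steers `x`. -/
noncomputable def correction : ℝ := S.M * (1 + S.M * S.controlBound)

/-- Lipschitz constant of the solutions of the scheme. -/
noncomputable def lipBound : ℝ :=
  2 * S.M * S.controlBound + S.correction * (2 * S.M + 2 * S.controlBound + S.correction)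

theorem correction_pos : 0 < S.correction := by
  have := S.M_pos
  have := S.one_le_controlBound
  unfold correction; positivity

theorem lipBound_pos : 0 < S.lipBound := by
  have := S.M_pos
  have := S.one_le_controlBound
  have := S.correction_pos
  unfold lipBound; positivity

-- Take `α` nearly optimal at one point. From the other point, a corrected control `α + e` reaches
-- the same endpoint, so the values of `u` there cancel and only two rewards are compared. Since
-- `h‖e‖` is of the order of the distance between the points, so is the loss.
include h0 h1 hu0 huM hup in
theorem scheme_lipschitz
    (hdn : ∀ x, ∀ η > 0, ∃ α, u x - η ≤ (1 - h ^ 2) * u (S.euler h x α) + h * S.reward x α)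
    (x z : E) : u z - u x ≤ S.lipBound * ‖z - x‖ := by
  have hM := S.M_pos
  have hB := S.one_le_controlBound
  have hC := S.correction_pos
  refine sub_le_of_forall_norm_sub_le_local h0 (fun x' x hd => ?_) S.lipBound_pos.le x z
  refine le_of_forall_pos_le_add fun η hη => ?_
  obtain ⟨α, hα⟩ := hdn x (min η h) (lt_min hη h0)
  have hαB : ‖α‖ ≤ S.controlBound := S.norm_control_le h0 hu0 huM hup (x := x)
    (le_trans (by linarith [min_le_right η h]) hα)
  set d := ‖x - x'‖
  set e : G := (1 / (2 * h)) • S.R x' (x - x' + (2 * h) • (S.A x α - S.A x' α)) with he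
  have h2 := hup x' (α + e)
  have hz : S.euler h x' (α + e) = S.euler h x α := by
    rw [he, euler, map_add, map_smul, S.A_R, smul_add, smul_smul, euler]
    have : 2 * h * (1 / (2 * h)) = 1 := by field_simp
    rw [this, one_smul, smul_sub]; abel
  rw [hz] at h2
  have h3 := S.reward_sub_le x x' α (α + e)
  rw [add_sub_cancel_left] at h3
  have hd0 : 0 ≤ d := norm_nonneg _
  have h4 : h * ‖e‖ ≤ S.correction * d := by
    rw [he, norm_smul, Real.norm_of_nonneg (by positivity)]
    have h5 : ‖x - x' + (2 * h) • (S.A x α - S.A x' α)‖ ≤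
        d + 2 * h * (S.M * d * S.controlBound) := by
      refine (norm_add_le _ _).trans ?_
      rw [norm_smul, Real.norm_of_nonneg (by positivity)]
      gcongr
      exact (S.norm_A_sub_apply_le x x' α).trans (by gcongr)
    calc h * (1 / (2 * h) * _) ≤
        h * (1 / (2 * h) * (S.M * (d + 2 * h * (S.M * d * S.controlBound)))) := by
          gcongr
          exact (S.norm_R_apply_le _ _).trans (by gcongr)
      _ = S.M * (d / 2 + h * (S.M * d * S.controlBound)) := by field_simp
      _ ≤ S.M * (d + 1 * (S.M * d * S.controlBound)) := by gcongr; linarith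
      _ = S.correction * d := by unfold correction; ring
  have h6 : ‖e‖ ≤ S.correction := by
    have : h * ‖e‖ ≤ h * S.correction := h4.trans (by rw [mul_comm h]; gcongr)
    exact le_of_mul_le_mul_left this h0
  have h7 : h * (S.reward x α - S.reward x' (α + e)) ≤ S.lipBound * d := by
    calc _ ≤ h * (2 * S.M * d * ‖α‖ + ‖e‖ * (2 * S.M + 2 * ‖α‖ + ‖e‖)) := by gcongr
      _ = h * (2 * S.M * d * ‖α‖) + h * ‖e‖ * (2 * S.M + 2 * ‖α‖ + ‖e‖) := by ring
      _ ≤ 1 * (2 * S.M * d * S.controlBound) + S.correction * d *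
          (2 * S.M + 2 * S.controlBound + S.correction) := by gcongr
      _ = _ := by unfold lipBound; ring
  linarith [min_le_left η h]

/-- A constant for the solutions of the scheme. -/
noncomputable def schemeBound : ℝ :=
  S.lipBound * S.M + S.lipBound + S.M ^ 2 + S.controlBound + 1

/-- Discounting removes `h² u` per step. Periodicity and the Lipschitz bound keep the oscillation of
`u` bounded, so `h² u` differs from `h · (h u(0))` by `O(h²)`, which goes into the error term. -/
theorem exists_isSchemeSolution {h : ℝ} (h0 : 0 < h) (h1 : h ≤ 1) :
    ∃ c w, S.IsSchemeSolution h S.schemeBound c w := by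
  obtain ⟨u, hu0, huM, hper, hup, hdn⟩ := S.exists_discounted_fixedPoint h0 h1
  have hL := S.scheme_lipschitz h0 h1 hu0 huM hup hdn
  have hM := S.M_pos
  have hB := S.one_le_controlBound
  have hK := S.lipBound_pos
  have hKM : 0 < S.lipBound * S.M := by positivity
  have hM2 : 0 < S.M ^ 2 := by positivity
  have habs : ∀ x, |u x - u 0| ≤ S.lipBound * S.M := by
    intro x
    obtain ⟨k, hk, hkM⟩ := S.cover x
    rw [← hper x k hk, _root_.abs_le]
    have a1 := hL 0 (x + k)
    have a2 := hL (x + k) 0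
    rw [sub_zero] at a1
    rw [zero_sub, norm_neg] at a2
    have : S.lipBound * ‖x + k‖ ≤ S.lipBound * S.M := by gcongr
    constructor <;> linarith
  have habs' : ∀ x, u 0 * h ^ 2 - S.lipBound * S.M * h ^ 2 ≤ h ^ 2 * u x ∧
      h ^ 2 * u x ≤ u 0 * h ^ 2 + S.lipBound * S.M * h ^ 2 := fun x => by
    have := _root_.abs_le.1 (habs x)
    constructor <;> nlinarith [sq_nonneg h]
  have hbig : S.lipBound * S.M * h ^ 2 + h ^ 2 ≤ S.schemeBound * h ^ 2 := by
    rw [← sub_nonneg]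
    have : 0 ≤ (S.lipBound + S.M ^ 2 + S.controlBound) * h ^ 2 := by positivity
    calc 0 ≤ _ := this
      _ = _ := by unfold schemeBound; ring
  refine ⟨h * u 0, fun x => u x - u 0, mul_nonneg h0.le (hu0 0), ?_, ?_, ?_, ?_, ?_, ?_⟩
  · have : h * u 0 ≤ h * (S.M ^ 2 / h) := by gcongr; exact huM 0
    have e : h * (S.M ^ 2 / h) = S.M ^ 2 := by field_simp
    unfold schemeBound; linarith
  · intro x k hk; simp only [hper x k hk]
  · intro x z
    have : S.lipBound * ‖z - x‖ ≤ S.schemeBound * ‖z - x‖ := by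
      gcongr; unfold schemeBound; linarith
    linarith [hL x z]
  · intro x
    refine (habs x).trans ?_
    unfold schemeBound; linarith
  · intro x α
    have a1 := hup x α
    have a2 := (habs' (S.euler h x α)).2
    have a3 : 0 ≤ h ^ 2 := sq_nonneg h
    linarith
  · intro x
    -- The tolerance `h²` fits the error allowed per step and is at most `h`, as the bound on the
    -- control requires.
    obtain ⟨α, hα⟩ := hdn x (h ^ 2) (by positivity)
    refine ⟨α, (S.norm_control_le h0 hu0 huM hup (x := x) (le_trans ?_ hα)).trans ?_, ?_⟩
    · nlinarith
    · unfold schemeBound; linarith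
    · have a2 := (habs' (S.euler h x α)).1
      linarith

theorem one_le_schemeBound : 1 ≤ S.schemeBound := by
  have hM := S.M_pos
  have hB := S.one_le_controlBound
  have hK := S.lipBound_pos
  have hKM : 0 < S.lipBound * S.M := by positivity
  have hM2 : 0 < S.M ^ 2 := by positivity
  unfold schemeBound; linarith

end PeriodicSystem

/-! ### From the scheme to the cell problem -/

/-- Perturbation of maximum points under locally uniform convergence. -/
theorem exists_tendsto_max_of_tendstoUniformlyOn {ι E : Type*} [NormedAddCommGroup E]
    [NormedSpace ℝ E] [ProperSpace E] {l : Filter ι} {f : ι → E → ℝ} {g : E → ℝ} {x₀ : E} {r : ℝ}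
    (hr : 0 < r) (hf : ∀ k, Continuous (f k))
    (hfg : ∀ ε > 0, ∀ᶠ k in l, ∀ x ∈ Metric.closedBall x₀ r, |f k x - g x| ≤ ε)
    (hg : ∀ x ∈ Metric.closedBall x₀ r, g x ≤ g x₀) :
    ∃ x : ι → E, Tendsto x l (𝓝 x₀) ∧
      ∀ k, ∀ z ∈ Metric.closedBall x₀ r, f k z - ‖z - x₀‖ ^ 2 ≤ f k (x k) - ‖x k - x₀‖ ^ 2 := by
  have hx₀ : x₀ ∈ Metric.closedBall x₀ r := Metric.mem_closedBall_self hr.le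
  have hmax : ∀ k, ∃ x ∈ Metric.closedBall x₀ r, ∀ z ∈ Metric.closedBall x₀ r,
      f k z - ‖z - x₀‖ ^ 2 ≤ f k x - ‖x - x₀‖ ^ 2 := fun k =>
    (isCompact_closedBall x₀ r).exists_isMaxOn ⟨x₀, hx₀⟩ (f := fun z => f k z - ‖z - x₀‖ ^ 2)
      (by have := hf k; fun_prop)
  choose x hx hxm using hmax
  refine ⟨x, ?_, hxm⟩
  rw [Metric.tendsto_nhds]
  intro ε hε
  -- Comparing the penalized values at `x k` and at `x₀` gives `‖x k - x₀‖² ≤ ε² / 2`.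
  filter_upwards [hfg (ε ^ 2 / 4) (by positivity)] with k hk
  have a1 := abs_le.1 (hk (x k) (hx k))
  have a2 := abs_le.1 (hk x₀ hx₀)
  have a3 := hxm k x₀ hx₀
  have a4 := hg (x k) (hx k)
  rw [sub_self, norm_zero] at a3
  rw [dist_eq_norm]
  have : ‖x k - x₀‖ ^ 2 < ε ^ 2 := by nlinarith
  exact lt_of_pow_lt_pow_left₀ 2 hε.le this

/-- Pointwise convergence of uniformly Lipschitz functions is locally uniform. -/
theorem eventually_forall_mem_closedBall_abs_sub_le {ι E : Type*} [NormedAddCommGroup E]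
    [ProperSpace E] {l : Filter ι} [l.NeBot] {f : ι → E → ℝ} {g : E → ℝ} {K : ℝ}
    (hf : ∀ k x z, f k z - f k x ≤ K * ‖z - x‖) (hfg : ∀ x, Tendsto (fun k => f k x) l (𝓝 (g x)))
    (hK : 0 < K) (x₀ : E) (r : ℝ) {ε : ℝ} (hε : 0 < ε) :
    ∀ᶠ k in l, ∀ x ∈ Metric.closedBall x₀ r, |f k x - g x| ≤ ε := by
  have hg : ∀ x z, g z - g x ≤ K * ‖z - x‖ := fun x z =>
    le_of_tendsto ((hfg z).sub (hfg x)) (Eventually.of_forall fun k => hf k x z)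
  obtain ⟨t, -, ht, hcov⟩ := (isCompact_closedBall x₀ r).finite_cover_balls
    (show 0 < ε / (4 * K) by positivity)
  have h1 : ∀ᶠ k in l, ∀ y ∈ t, |f k y - g y| < ε / 2 := by
    rw [eventually_all_finite ht]
    intro y _
    have := (Metric.tendsto_nhds.1 (hfg y)) (ε / 2) (by positivity)
    simpa only [Real.dist_eq] using this
  filter_upwards [h1] with k hk x hx
  obtain ⟨y, hy, hxy⟩ := mem_iUnion₂.1 (hcov hx)
  rw [Metric.mem_ball, dist_eq_norm] at hxy
  have e : K * ‖x - y‖ ≤ ε / 4 := by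
    calc K * ‖x - y‖ ≤ K * (ε / (4 * K)) := by gcongr
      _ = ε / 4 := by field_simp
  have a1 := hf k x y
  have a2 := hf k y x
  have a3 := hg x y
  have a4 := hg y x
  rw [norm_sub_rev] at a1 a3
  have a5 := abs_lt.1 (hk y hy)
  rw [abs_le]
  constructor <;> linarith

namespace PeriodicSystem

variable {E G : Type*} [NormedAddCommGroup E] [InnerProductSpace ℝ E] [FiniteDimensional ℝ E]
    [NormedAddCommGroup G] [InnerProductSpace ℝ G] [FiniteDimensional ℝ G]
    (S : PeriodicSystem E G)

/-- The Hamiltonian `|A(y)ᵀ q + s(y)|²`. -/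
noncomputable def ham (y q : E) : ℝ := ‖ContinuousLinearMap.adjoint (S.A y) q + S.s y‖ ^ 2

/-- Completing the square: the Hamiltonian is the maximum over `α`, attained at `α = Aᵀq + s`. -/
theorem reward_eq (y q : E) (α : G) : 2 * inner ℝ q (S.A y α) + S.reward y α =
    S.ham y q - ‖ContinuousLinearMap.adjoint (S.A y) q + S.s y - α‖ ^ 2 := by
  rw [ham, norm_sub_sq_real, inner_add_left, ContinuousLinearMap.adjoint_inner_left, reward]
  ring

theorem reward_le_ham (y q : E) (α : G) :
    2 * inner ℝ q (S.A y α) + S.reward y α ≤ S.ham y q := by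
  rw [reward_eq]; linarith [sq_nonneg ‖ContinuousLinearMap.adjoint (S.A y) q + S.s y - α‖]

omit [FiniteDimensional ℝ E] [FiniteDimensional ℝ G] in
theorem continuous_A : Continuous S.A :=
  (LipschitzWith.of_dist_le_mul (K := ⟨S.M, S.M_pos.le⟩)
    fun x y => by rw [dist_eq_norm, dist_eq_norm]; exact S.A_lip x y).continuous

omit [FiniteDimensional ℝ E] [FiniteDimensional ℝ G] in
theorem continuous_s : Continuous S.s :=
  (LipschitzWith.of_dist_le_mul (K := ⟨S.M, S.M_pos.le⟩)
    fun x y => by rw [dist_eq_norm, dist_eq_norm]; exact S.s_lip x y).continuous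

theorem continuous_ham (q : E) : Continuous fun y => S.ham y q := by
  have h1 := S.continuous_A
  have h2 := S.continuous_s
  unfold ham
  have h3 : Continuous fun y => ContinuousLinearMap.adjoint (S.A y) :=
    (ContinuousLinearMap.adjoint : (G →L[ℝ] E) ≃ₗᵢ⋆[ℝ] (E →L[ℝ] G)).continuous.comp h1
  exact (((h3.clm_apply continuous_const).add h2).norm.pow 2)

/-- Periodic viscosity solutions of the cell problem `c - H(y, Dw(y)) = 0`. -/
structure IsCellSolution (c : ℝ) (w : E → ℝ) : Prop where
  continuous : Continuous w
  add_period : ∀ x, ∀ k ∈ S.P, w (x + k) = w x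
  le_ham : ∀ φ : E → ℝ, ContDiff ℝ 1 φ → ∀ y,
    IsLocalMax (fun z => w z - φ z) y → c ≤ S.ham y (gradient φ y)
  ham_le : ∀ φ : E → ℝ, ContDiff ℝ 1 φ → ∀ y,
    IsLocalMin (fun z => w z - φ z) y → S.ham y (gradient φ y) ≤ c

section limit

variable {S} {l : Filter ℕ} [l.NeBot] {h : ℕ → ℝ} {K : ℝ} {c : ℕ → ℝ} {w : ℕ → E → ℝ}
  {c' : ℝ} {w' : E → ℝ}

theorem eventually_abs_increment_le {φ : E → ℝ} (hφ : ContDiff ℝ 1 φ) (x₀ : E) {ε : ℝ}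
    (hε : 0 < ε) : ∀ᶠ p : E × E in 𝓝 (x₀, x₀), |φ p.1 - φ p.2 - inner ℝ (gradient φ x₀)
      (p.1 - p.2)| ≤ ε * ‖p.1 - p.2‖ := by
  have h1 := (hφ.contDiffAt (x := x₀)).hasStrictFDerivAt one_ne_zero
  have h2 := h1.isLittleO.def hε
  filter_upwards [h2] with p hp
  rw [Real.norm_eq_abs] at hp
  rwa [gradient, InnerProductSpace.toDual_symm_apply]

/-- The quadratic penalty is stationary at `x₀`, so its increments nearby are as negligible as the
first-order error of `φ`. Both endpoints move, which is why strict differentiability is used. -/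
theorem eventually_abs_increment_add_sq_le {φ : E → ℝ} (hφ : ContDiff ℝ 1 φ) (x₀ : E) {ε : ℝ}
    (hε : 0 < ε) : ∀ᶠ p : E × E in 𝓝 (x₀, x₀), |φ p.1 - φ p.2 - inner ℝ (gradient φ x₀)
      (p.1 - p.2)| + |‖p.1 - x₀‖ ^ 2 - ‖p.2 - x₀‖ ^ 2| ≤ ε * ‖p.1 - p.2‖ := by
  have h1 := eventually_abs_increment_le hφ x₀ (half_pos hε)
  have h2 : ∀ᶠ p : E × E in 𝓝 (x₀, x₀), ‖p.1 - x₀‖ + ‖p.2 - x₀‖ < ε / 2 := by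
    have : Continuous fun p : E × E => ‖p.1 - x₀‖ + ‖p.2 - x₀‖ := by fun_prop
    exact (this.tendsto (x₀, x₀)).eventually_lt_const (by simpa using half_pos hε)
  filter_upwards [h1, h2] with p hp1 hp2
  have h3 : |‖p.1 - x₀‖ ^ 2 - ‖p.2 - x₀‖ ^ 2| ≤ ε / 2 * ‖p.1 - p.2‖ := by
    have e : ‖p.1 - x₀‖ ^ 2 - ‖p.2 - x₀‖ ^ 2 =
      (‖p.1 - x₀‖ + ‖p.2 - x₀‖) * (‖p.1 - x₀‖ - ‖p.2 - x₀‖) := by ring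
    rw [e, abs_mul, abs_of_nonneg (by positivity)]
    gcongr
    simpa using abs_norm_sub_norm_le (p.1 - x₀) (p.2 - x₀)
  linarith

omit [FiniteDimensional ℝ E] [FiniteDimensional ℝ G] [l.NeBot] in
theorem tendsto_euler (hh : Tendsto h l (𝓝 0)) {x : ℕ → E} {x₀ : E} (hx : Tendsto x l (𝓝 x₀))
    {α : ℕ → G} {B : ℝ} (hα : ∀ k, ‖α k‖ ≤ B) :
    Tendsto (fun k => S.euler (h k) (x k) (α k)) l (𝓝 x₀) := by
  have : Tendsto (fun k => (2 * h k) • S.A (x k) (α k)) l (𝓝 0) := by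
    have h2 : Tendsto (fun k => 2 * |h k| * (S.M * B)) l (𝓝 0) := by
      have := ((hh.abs).const_mul 2).mul_const (S.M * B)
      simpa using this
    refine squeeze_zero_norm (fun k => ?_) h2
    rw [norm_smul, norm_mul, Real.norm_two, Real.norm_eq_abs]
    gcongr
    exact (S.norm_A_apply_le _ _).trans
      (mul_le_mul_of_nonneg_left (hα k) S.M_pos.le)
  simpa [euler] using hx.add this

variable (hh0 : ∀ k, 0 < h k) (hh : Tendsto h l (𝓝 0))
  (hw : ∀ k, S.IsSchemeSolution (h k) K (c k) (w k)) (hK : 0 < K)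
  (hc : Tendsto c l (𝓝 c')) (hw' : ∀ x, Tendsto (fun k => w k x) l (𝓝 (w' x)))
include hh0 hh hw hK hc hw'

omit [FiniteDimensional ℝ E] [FiniteDimensional ℝ G] hh0 hh hc in
theorem IsSchemeSolution.continuous_limit : Continuous w' :=
  (LipschitzWith.of_le_add_mul ⟨K, hK.le⟩ fun x y => by
    have : w' x - w' y ≤ K * ‖x - y‖ :=
      le_of_tendsto ((hw' x).sub (hw' y)) (Eventually.of_forall fun k => (hw k).lip y x)
    rw [dist_eq_norm]
    change w' x ≤ w' y + K * ‖x - y‖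
    linarith).continuous

omit [l.NeBot] [FiniteDimensional ℝ E] [FiniteDimensional ℝ G] hh0 hh hc hw' in
theorem IsSchemeSolution.continuous (k : ℕ) : Continuous (w k) :=
  (LipschitzWith.of_le_add_mul ⟨K, hK.le⟩ fun x y => by
    have := (hw k).lip y x
    rw [dist_eq_norm]
    change w k x ≤ w k y + K * ‖x - y‖
    linarith).continuous

/-- At a penalized maximum point, `w k` increases in an Euler step by no more than `φ` plus the
penalty. Inserting a nearly optimal control gives `c k ≤ 2⟨Dφ, Aα⟩ + reward + o(1)`, which the
Hamiltonian dominates. The bound on the controls makes the step `O(h)`. -/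
theorem IsSchemeSolution.le_ham_limit {φ : E → ℝ} (hφ : ContDiff ℝ 1 φ) {x₀ : E}
    (hmax : IsLocalMax (fun z => w' z - φ z) x₀) : c' ≤ S.ham x₀ (gradient φ x₀) := by
  obtain ⟨r, hr, hball⟩ := Metric.nhds_basis_closedBall.mem_iff.1 hmax
  obtain ⟨x, hx, hxm⟩ := exists_tendsto_max_of_tendstoUniformlyOn (l := l) hr
    (f := fun k z => w k z - φ z) (g := fun z => w' z - φ z)
    (fun k => (IsSchemeSolution.continuous hw hK k).sub hφ.continuous)
    (fun ε hε => by
      simpa only [sub_sub_sub_cancel_right] using eventually_forall_mem_closedBall_abs_sub_le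
        (fun k => (hw k).lip) hw' hK x₀ r hε) (fun z hz => hball hz)
  choose α hαK hα using fun k => (hw k).sub (x k)
  have hz := tendsto_euler (S := S) hh hx hαK
  refine le_of_forall_pos_le_add fun ε hε => ?_
  have hM := S.M_pos
  have hev := (hz.prodMk_nhds hx).eventually (eventually_abs_increment_add_sq_le hφ x₀
    (show 0 < ε / (2 * (S.M * K)) by positivity))
  have hlim1 : Tendsto (fun k => c k - K * h k) l (𝓝 (c' - K * 0)) := hc.sub (hh.const_mul K)
  have hlim2 : Tendsto (fun k => S.ham (x k) (gradient φ x₀) + ε) l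
      (𝓝 (S.ham x₀ (gradient φ x₀) + ε)) :=
    (((S.continuous_ham _).tendsto x₀).comp hx).add_const ε
  rw [mul_zero, sub_zero] at hlim1
  refine le_of_tendsto_of_tendsto hlim1 hlim2 ?_
  filter_upwards [hev, hz.eventually (Metric.closedBall_mem_nhds x₀ hr)] with k hk hkb
  have a1 := hxm k _ hkb
  have a2 := hα k
  have a3 := S.reward_le_ham (x k) (gradient φ x₀) (α k)
  have hpos := hh0 k
  have a4 := S.norm_euler_sub hpos (x k) (α k)
  have a5 : inner ℝ (gradient φ x₀) (S.euler (h k) (x k) (α k) - x k) =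
      h k * (2 * inner ℝ (gradient φ x₀) (S.A (x k) (α k))) := by
    rw [euler, add_sub_cancel_left, inner_smul_right]; ring
  rw [a5] at hk
  set z := S.euler (h k) (x k) (α k)
  have a6 : ε / (2 * (S.M * K)) * ‖z - x k‖ ≤ h k * ε := by
    calc _ ≤ ε / (2 * (S.M * K)) * (2 * h k * (S.M * K)) := by
          gcongr
          exact a4.trans (by gcongr; exact hαK k)
      _ = h k * ε := by field_simp
  have a7 := le_abs_self (φ z - φ (x k) - h k * (2 * inner ℝ (gradient φ x₀) (S.A (x k) (α k))))
  have a8 := neg_abs_le (‖z - x₀‖ ^ 2 - ‖x k - x₀‖ ^ 2)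
  have a8' := le_abs_self (‖z - x₀‖ ^ 2 - ‖x k - x₀‖ ^ 2)
  have a9 : h k * (c k - K * h k) ≤ h k * (S.ham (x k) (gradient φ x₀) + ε) := by
    have := mul_le_mul_of_nonneg_left a3 hpos.le
    nlinarith
  exact le_of_mul_le_mul_left a9 hpos

/-- The scheme inequality used here holds for every control, so one control suffices along the whole
sequence: the maximizer in the Hamiltonian at `x₀`. -/
theorem IsSchemeSolution.ham_limit_le {φ : E → ℝ} (hφ : ContDiff ℝ 1 φ) {x₀ : E}
    (hmin : IsLocalMin (fun z => w' z - φ z) x₀) : S.ham x₀ (gradient φ x₀) ≤ c' := by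
  obtain ⟨r, hr, hball⟩ := Metric.nhds_basis_closedBall.mem_iff.1 hmin
  obtain ⟨x, hx, hxm⟩ := exists_tendsto_max_of_tendstoUniformlyOn (l := l) hr
    (f := fun k z => φ z - w k z) (g := fun z => φ z - w' z)
    (fun k => hφ.continuous.sub (IsSchemeSolution.continuous hw hK k))
    (fun ε hε => by
      simpa only [sub_sub_sub_cancel_left, abs_sub_comm] using
        eventually_forall_mem_closedBall_abs_sub_le (fun k => (hw k).lip) hw' hK x₀ r hε)
    (fun z hz => by have : w' x₀ - φ x₀ ≤ w' z - φ z := hball hz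
                    linarith)
  set g := gradient φ x₀ with hg
  set α : G := ContinuousLinearMap.adjoint (S.A x₀) g + S.s x₀ with hαdef
  have hz := tendsto_euler (S := S) hh hx (α := fun _ => α) (fun _ => le_rfl)
  refine le_of_forall_pos_le_add fun ε hε => ?_
  have hM := S.M_pos
  have hev := (hz.prodMk_nhds hx).eventually (eventually_abs_increment_add_sq_le hφ x₀
    (show 0 < ε / (2 * (S.M * (‖α‖ + 1))) by positivity))
  have hlim1 : Tendsto (fun k => c k + K * h k + ε) l (𝓝 (c' + K * 0 + ε)) :=
    (hc.add (hh.const_mul K)).add_const ε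
  rw [mul_zero, add_zero] at hlim1
  have hlim2 : Tendsto (fun k => 2 * inner ℝ g (S.A (x k) α) + S.reward (x k) α) l
      (𝓝 (S.ham x₀ g)) := by
    have e : S.ham x₀ g = 2 * inner ℝ g (S.A x₀ α) + S.reward x₀ α := by
      rw [S.reward_eq, hαdef]; simp
    rw [e]
    have : Continuous fun y => 2 * inner ℝ g (S.A y α) + S.reward y α := by
      have h1 := S.continuous_A
      have h2 := S.continuous_s
      unfold reward
      fun_prop
    exact (this.tendsto x₀).comp hx
  refine le_of_tendsto_of_tendsto hlim2 hlim1 ?_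
  filter_upwards [hev, hz.eventually (Metric.closedBall_mem_nhds x₀ hr)] with k hk hkb
  have a1 := hxm k _ hkb
  have a2 := (hw k).super (x k) α
  have hpos := hh0 k
  have a4 := S.norm_euler_sub hpos (x k) α
  have a5 : inner ℝ g (S.euler (h k) (x k) α - x k) =
      h k * (2 * inner ℝ g (S.A (x k) α)) := by
    rw [euler, add_sub_cancel_left, inner_smul_right]; ring
  rw [a5] at hk
  set z := S.euler (h k) (x k) α
  have a6 : ε / (2 * (S.M * (‖α‖ + 1))) * ‖z - x k‖ ≤ h k * ε := by
    calc _ ≤ ε / (2 * (S.M * (‖α‖ + 1))) * (2 * h k * (S.M * (‖α‖ + 1))) := by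
          gcongr
          exact a4.trans (by gcongr; linarith)
      _ = h k * ε := by field_simp
  have a7 := neg_abs_le (φ z - φ (x k) - h k * (2 * inner ℝ g (S.A (x k) α)))
  have a8' := le_abs_self (‖z - x₀‖ ^ 2 - ‖x k - x₀‖ ^ 2)
  have a9 : h k * (2 * inner ℝ g (S.A (x k) α) + S.reward (x k) α) ≤
      h k * (c k + K * h k + ε) := by
    nlinarith
  exact le_of_mul_le_mul_left a9 hpos

end limit

/-- Existence of a solution of the cell problem as a limit of solutions of the scheme. -/
theorem exists_isCellSolution : ∃ (c : ℝ) (w : E → ℝ), S.IsCellSolution c w ∧ 0 ≤ c ∧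
    ∀ ε > 0, ∃ h, 0 < h ∧ h ≤ 1 ∧ h ≤ ε ∧ ∃ c₁ w₁, |c₁ - c| ≤ ε ∧
      S.IsSchemeSolution h S.schemeBound c₁ w₁ := by
  let h : ℕ → ℝ := fun k => 1 / ((k : ℝ) + 1)
  have hh0 : ∀ k, 0 < h k := fun k => Nat.one_div_pos_of_nat
  have hh1 : ∀ k, h k ≤ 1 := fun k => by
    simp only [h]; rw [div_le_one (by positivity)]; linarith [(Nat.cast_nonneg k : (0 : ℝ) ≤ k)]
  choose c w hw using fun k => S.exists_isSchemeSolution (hh0 k) (hh1 k)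
  -- Along an ultrafilter every bounded sequence converges, so the constants and the values at all
  -- points converge at once, without extracting subsequences.
  let l : Ultrafilter ℕ := hyperfilter ℕ
  have hl : (l : Filter ℕ) ≤ atTop := by
    rw [← Nat.cofinite_eq_atTop]; exact hyperfilter_le_cofinite
  have hh : Tendsto h l (𝓝 0) := tendsto_one_div_add_atTop_nhds_zero_nat.mono_left hl
  have key : ∀ (f : ℕ → ℝ) (a b : ℝ), (∀ k, f k ∈ Icc a b) → ∃ y ∈ Icc a b,
      Tendsto f l (𝓝 y) := fun f a b hf => by
    obtain ⟨y, hy, hy'⟩ := isCompact_Icc.ultrafilter_le_nhds' (l.map f) (s := Icc a b)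
      (Filter.mem_map.2 (Filter.univ_mem' hf))
    exact ⟨y, hy, hy'⟩
  obtain ⟨c', hc'mem, hc'⟩ := key c 0 S.schemeBound fun k => ⟨(hw k).nonneg, (hw k).le⟩
  choose w' _ hw' using fun x => key (fun k => w k x) (-S.schemeBound) S.schemeBound
    fun k => abs_le.1 ((hw k).abs_le x)
  have hK : 0 < S.schemeBound := one_pos.trans_le S.one_le_schemeBound
  refine ⟨c', w', ⟨IsSchemeSolution.continuous_limit hw hK hw', fun x k hk => ?_,
    fun φ hφ y hy => IsSchemeSolution.le_ham_limit hh0 hh hw hK hc' hw' hφ hy,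
    fun φ hφ y hy => IsSchemeSolution.ham_limit_le hh0 hh hw hK hc' hw' hφ hy⟩, hc'mem.1,
    fun ε hε => ?_⟩
  · refine tendsto_nhds_unique (hw' (x + k)) ?_
    simpa only [(hw _).add_period x k hk] using hw' x
  · have e1 := hh.eventually_le_const hε
    have e2 := (Metric.tendsto_nhds.1 hc') ε hε
    obtain ⟨k, hk1, hk2⟩ := (e1.and e2).exists
    exact ⟨h k, hh0 k, hh1 k, hk1, c k, w k, by rw [Real.dist_eq] at hk2; exact hk2.le, hw k⟩

end PeriodicSystem

/-! ### Uniqueness of the constant, and the uncorrelated case -/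

theorem hasGradientAt_const_mul_norm_sub_sq {E : Type*} [NormedAddCommGroup E]
    [InnerProductSpace ℝ E] [CompleteSpace E] (a : ℝ) (b y : E) :
    HasGradientAt (fun z => a * ‖z - b‖ ^ 2) ((2 * a) • (y - b)) y := by
  have h1 := ((hasStrictFDerivAt_norm_sq (y - b)).hasFDerivAt.comp y
    ((hasFDerivAt_id y).sub_const b)).const_mul a
  rw [hasGradientAt_iff_hasFDerivAt]
  refine h1.congr_fderiv ?_
  ext v
  simp [InnerProductSpace.toDual_apply_apply]
  ring

theorem contDiff_const_mul_norm_sub_sq {E : Type*} [NormedAddCommGroup E]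
    [InnerProductSpace ℝ E] (a : ℝ) (b : E) :
    ContDiff ℝ 1 (fun z => a * ‖z - b‖ ^ 2) :=
  contDiff_const.mul ((contDiff_id.sub contDiff_const).norm_sq ℝ)

theorem exists_isLocalMin_add_mul_norm_sub_sq {E : Type*} [NormedAddCommGroup E]
    [NormedSpace ℝ E] [ProperSpace E] {g : E → ℝ} {B : ℝ} (hg : Continuous g)
    (hB : ∀ x, |g x| ≤ B) (y₀ : E) {r : ℝ} (hr : 0 < r) :
    ∃ N : ℝ, ∃ y ∈ Metric.ball y₀ r, IsLocalMin (fun z => g z + N * ‖z - y₀‖ ^ 2) y := by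
  have hB0 : 0 ≤ B := (abs_nonneg _).trans (hB y₀)
  -- On the sphere of radius `r` the penalty equals `2B + 1`, more than the oscillation of `g`, so
  -- the minimum is interior.
  set N : ℝ := (2 * B + 1) / r ^ 2 with hN
  have hN0 : 0 < N := by positivity
  have hNr : N * r ^ 2 = 2 * B + 1 := by rw [hN]; field_simp
  obtain ⟨y, hy, hmin⟩ := (isCompact_closedBall y₀ r).exists_isMinOn
    ⟨y₀, Metric.mem_closedBall_self hr.le⟩ (f := fun z => g z + N * ‖z - y₀‖ ^ 2)
    (by fun_prop)
  have h1 : g y + N * ‖y - y₀‖ ^ 2 ≤ g y₀ + N * ‖y₀ - y₀‖ ^ 2 :=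
    hmin (Metric.mem_closedBall_self hr.le)
  rw [sub_self, norm_zero] at h1
  have hyr : y ∈ Metric.ball y₀ r := by
    rw [mem_ball_iff_norm]
    refine lt_of_pow_lt_pow_left₀ 2 hr.le (lt_of_mul_lt_mul_left ?_ hN0.le)
    linarith [(abs_le.1 (hB y)).1, (abs_le.1 (hB y₀)).2]
  refine ⟨N, y, hyr, ?_⟩
  filter_upwards [Metric.isOpen_ball.mem_nhds hyr] with z hz
  exact hmin (Metric.ball_subset_closedBall hz)

namespace PeriodicSystem

variable {E G : Type*} [NormedAddCommGroup E] [InnerProductSpace ℝ E] [FiniteDimensional ℝ E]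
    [NormedAddCommGroup G] [InnerProductSpace ℝ G] [FiniteDimensional ℝ G]
    {S : PeriodicSystem E G}

omit [FiniteDimensional ℝ G] in
theorem exists_abs_le_of_continuous_of_add_period {w : E → ℝ} (hw : Continuous w)
    (hp : ∀ x, ∀ k ∈ S.P, w (x + k) = w x) : ∃ B, ∀ x, |w x| ≤ B := by
  obtain ⟨B, hB⟩ := (isCompact_closedBall (0 : E) S.M).exists_bound_of_continuousOn
    hw.continuousOn
  refine ⟨B, fun x => ?_⟩
  obtain ⟨k, hk, hkM⟩ := S.cover x
  rw [← hp x k hk]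
  exact hB _ (by simpa using hkM)

/-- Coercivity: `AR = 1` gives `‖q‖² = ⟨Aᵀq, Rq⟩`, hence `‖q‖ ≤ M‖Aᵀq‖`. -/
theorem norm_le_of_ham_le {y q : E} {c : ℝ} (h : S.ham y q ≤ c) :
    ‖q‖ ≤ S.M * (Real.sqrt c + S.M) := by
  have hM := S.M_pos
  have h1 : ‖ContinuousLinearMap.adjoint (S.A y) q + S.s y‖ ≤ Real.sqrt c :=
    Real.le_sqrt_of_sq_le h
  have h2 : ‖ContinuousLinearMap.adjoint (S.A y) q‖ ≤ Real.sqrt c + S.M := by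
    have := norm_sub_le (ContinuousLinearMap.adjoint (S.A y) q + S.s y) (S.s y)
    rw [add_sub_cancel_right] at this
    linarith [S.norm_s_le y]
  have h3 : ‖q‖ ^ 2 ≤ (Real.sqrt c + S.M) * (S.M * ‖q‖) := by
    calc ‖q‖ ^ 2 = inner ℝ (ContinuousLinearMap.adjoint (S.A y) q) (S.R y q) := by
          rw [ContinuousLinearMap.adjoint_inner_left, S.A_R, real_inner_self_eq_norm_sq]
      _ ≤ _ := real_inner_le_norm _ _
      _ ≤ _ := by
        gcongr
        exact S.norm_R_apply_le y q
  rcases (norm_nonneg q).eq_or_lt with h0 | h0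
  · rw [← h0]; positivity
  · refine le_of_mul_le_mul_right ?_ h0
    nlinarith

/-- The square root of the Hamiltonian is Lipschitz in the point, with a constant linear in `‖q‖`.
This is why `IsCellSolution.le` compares square roots of the constants. -/
theorem ham_sub_le (x y q : E) :
    ‖ContinuousLinearMap.adjoint (S.A x) q + S.s x‖ ≤
      ‖ContinuousLinearMap.adjoint (S.A y) q + S.s y‖ + S.M * ‖x - y‖ * (‖q‖ + 1) := by
  have h1 : ‖ContinuousLinearMap.adjoint (S.A x - S.A y) q‖ ≤ S.M * ‖x - y‖ * ‖q‖ := by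
    refine ContinuousLinearMap.le_of_opNorm_le _ ?_ q
    rw [LinearIsometryEquiv.norm_map]
    exact S.A_lip x y
  have h2 : ContinuousLinearMap.adjoint (S.A x) q + S.s x =
      (ContinuousLinearMap.adjoint (S.A y) q + S.s y) +
      (ContinuousLinearMap.adjoint (S.A x - S.A y) q + (S.s x - S.s y)) := by
    rw [map_sub, sub_apply]; abel
  rw [h2]
  refine (norm_add_le _ _).trans ?_
  have := norm_add_le (ContinuousLinearMap.adjoint (S.A x - S.A y) q) (S.s x - S.s y)
  linarith [S.s_lip x y]

theorem IsCellSolution.nonneg {c : ℝ} {w : E → ℝ} (hw : S.IsCellSolution c w) : 0 ≤ c := by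
  obtain ⟨B, hB⟩ := exists_abs_le_of_continuous_of_add_period hw.continuous hw.add_period
  obtain ⟨N, y, -, hy⟩ := exists_isLocalMin_add_mul_norm_sub_sq hw.continuous hB 0 one_pos
  exact (sq_nonneg _).trans (hw.ham_le (fun z => -N * ‖z - 0‖ ^ 2)
    (contDiff_const_mul_norm_sub_sq _ _) y (by simpa using hy))

/-- Comparison of the constants of two solutions, by doubling the variables. -/
theorem IsCellSolution.le {c₁ c₂ : ℝ} {w₁ w₂ : E → ℝ} (h₁ : S.IsCellSolution c₁ w₁)
    (h₂ : S.IsCellSolution c₂ w₂) : c₁ ≤ c₂ := by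
  have hM := S.M_pos
  obtain ⟨B₁, hB₁⟩ := exists_abs_le_of_continuous_of_add_period h₁.continuous h₁.add_period
  obtain ⟨B₂, hB₂⟩ := exists_abs_le_of_continuous_of_add_period h₂.continuous h₂.add_period
  set B := B₁ + B₂ with hB
  have hB0 : 0 ≤ B := add_nonneg ((abs_nonneg _).trans (hB₁ 0)) ((abs_nonneg _).trans (hB₂ 0))
  set D := S.M * (Real.sqrt c₂ + S.M)
  have hD : 0 ≤ D := by positivity
  have key : ∀ N : ℕ, 1 ≤ N →
      Real.sqrt c₁ ≤ Real.sqrt c₂ + S.M * (D * (D + 1)) * (1 / (N : ℝ)) := by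
    intro N hN
    have hN1 : (1 : ℝ) ≤ N := by exact_mod_cast hN
    set f : E × E → ℝ := fun p => w₁ p.1 - w₂ p.2 - N * ‖p.1 - p.2‖ ^ 2 with hf
    have hfc : Continuous f := by
      have := h₁.continuous
      have := h₂.continuous
      fun_prop
    -- A common period shifts the first point into the ball of radius `M`. Points more than `1 + 2B`
    -- apart lose against `(0, 0)`, since the penalty then exceeds `2B`. A maximum over this compact
    -- set is therefore global.
    obtain ⟨⟨x, y⟩, -, hmax⟩ := ((isCompact_closedBall (0 : E) S.M).prod
      (isCompact_closedBall (0 : E) (S.M + (1 + 2 * B)))).exists_isMaxOn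
      ⟨(0, 0), by simp only [mem_prod, Metric.mem_closedBall, dist_self]
                  constructor <;> positivity⟩ hfc.continuousOn
    have hglob : ∀ a b, f (a, b) ≤ f (x, y) := by
      intro a b
      by_cases hab : ‖a - b‖ ≤ 1 + 2 * B
      · obtain ⟨k, hk, hkM⟩ := S.cover a
        have e : f (a, b) = f (a + k, b + k) := by
          simp only [hf, h₁.add_period a k hk, h₂.add_period b k hk, add_sub_add_right_eq_sub]
        rw [e]
        refine hmax ⟨by simpa using hkM, ?_⟩
        rw [mem_closedBall_zero_iff]
        have : b + k = (a + k) - (a - b) := by abel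
        rw [this]
        exact (norm_sub_le _ _).trans (by linarith)
      · push Not at hab
        have e0 : f (0, 0) ≤ f (x, y) := hmax ⟨by simpa using hM.le, by
          rw [mem_closedBall_zero_iff, norm_zero]; positivity⟩
        refine le_trans ?_ e0
        have a1 := abs_le.1 (hB₁ a)
        have a2 := abs_le.1 (hB₂ b)
        have a3 := abs_le.1 (hB₁ 0)
        have a4 := abs_le.1 (hB₂ 0)
        have a5 : 2 * B ≤ ‖a - b‖ ^ 2 := by nlinarith
        have a6 : ‖a - b‖ ^ 2 ≤ N * ‖a - b‖ ^ 2 := le_mul_of_one_le_left (sq_nonneg _) hN1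
        simp only [hf, sub_self, norm_zero]
        linarith
    have g1 := hasGradientAt_const_mul_norm_sub_sq (N : ℝ) y x
    have g2 := hasGradientAt_const_mul_norm_sub_sq (-N : ℝ) x y
    have i1 := h₁.le_ham _ (contDiff_const_mul_norm_sub_sq (N : ℝ) y) x
      (Eventually.of_forall fun z => by
        have := hglob z y
        simp only [hf] at this
        simp only
        linarith)
    have i2 := h₂.ham_le _ (contDiff_const_mul_norm_sub_sq (-N : ℝ) x) y
      (Eventually.of_forall fun z => by
        have := hglob x z
        simp only [hf] at this
        simp only
        rw [norm_sub_rev y x, norm_sub_rev z x]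
        linarith)
    rw [g1.gradient] at i1
    rw [g2.gradient] at i2
    have e : (2 * (-N : ℝ)) • (y - x) = (2 * (N : ℝ)) • (x - y) := by
      rw [← neg_sub x y, smul_neg, mul_neg, neg_smul, neg_neg]
    rw [e] at i2
    set q := (2 * (N : ℝ)) • (x - y) with hq
    -- Coercivity at the supersolution bounds the gradient `2N(x - y)`, so `‖x - y‖ = O(1/N)`
    -- without any Lipschitz regularity of `w₁` or `w₂`.
    have hqD : ‖q‖ ≤ D := norm_le_of_ham_le i2
    have j1 : Real.sqrt c₁ ≤ ‖ContinuousLinearMap.adjoint (S.A x) q + S.s x‖ :=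
      Real.sqrt_le_iff.2 ⟨norm_nonneg _, i1⟩
    have j2 : ‖ContinuousLinearMap.adjoint (S.A y) q + S.s y‖ ≤ Real.sqrt c₂ :=
      Real.le_sqrt_of_sq_le i2
    have j3 : ‖x - y‖ ≤ D * (1 / (N : ℝ)) := by
      rw [hq, norm_smul, Real.norm_of_nonneg (by positivity)] at hqD
      rw [mul_one_div, le_div_iff₀ (by positivity)]
      nlinarith [norm_nonneg (x - y)]
    calc Real.sqrt c₁ ≤ _ := j1
      _ ≤ _ := ham_sub_le x y q
      _ ≤ Real.sqrt c₂ + S.M * (D * (1 / (N : ℝ))) * (D + 1) := by gcongr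
      _ = _ := by ring
  have hlim : Tendsto (fun N : ℕ => Real.sqrt c₂ + S.M * (D * (D + 1)) * (1 / (N : ℝ))) atTop
      (𝓝 (Real.sqrt c₂ + S.M * (D * (D + 1)) * 0)) :=
    (tendsto_one_div_atTop_nhds_zero_nat.const_mul _).const_add _
  have hs := ge_of_tendsto hlim (eventually_atTop.2 ⟨1, key⟩)
  rw [mul_zero, add_zero] at hs
  exact (Real.sqrt_le_sqrt_iff h₂.nonneg).1 hs

theorem IsCellSolution.eq {c₁ c₂ : ℝ} {w₁ w₂ : E → ℝ} (h₁ : S.IsCellSolution c₁ w₁)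
    (h₂ : S.IsCellSolution c₂ w₂) : c₁ = c₂ :=
  le_antisymm (h₁.le h₂) (h₂.le h₁)

/-- If the drift is not seen by the dynamics, the constant is the maximum of the reward. -/
theorem IsCellSolution.isGreatest {c : ℝ} {w : E → ℝ} (hw : S.IsCellSolution c w)
    (hAs : ∀ y, S.A y (S.s y) = 0) : IsGreatest (range fun y => ‖S.s y‖ ^ 2) c := by
  have hs : ∀ y q, ‖S.s y‖ ^ 2 ≤ S.ham y q := by
    intro y q
    rw [ham, norm_add_sq_real, ContinuousLinearMap.adjoint_inner_left, hAs, inner_zero_right]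
    nlinarith [sq_nonneg ‖ContinuousLinearMap.adjoint (S.A y) q‖]
  obtain ⟨B, hB⟩ := exists_abs_le_of_continuous_of_add_period hw.continuous hw.add_period
  have hub : ∀ y, ‖S.s y‖ ^ 2 ≤ c := by
    intro y₀
    by_contra! hlt
    obtain ⟨r, hr, hball⟩ := Metric.nhds_basis_ball.mem_iff.1
      ((S.continuous_s.norm.pow 2).tendsto y₀ |>.eventually_const_lt hlt)
    obtain ⟨N, y, hyr, hy⟩ := exists_isLocalMin_add_mul_norm_sub_sq hw.continuous hB y₀ hr
    have h1 := hw.ham_le (fun z => -N * ‖z - y₀‖ ^ 2)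
      (contDiff_const_mul_norm_sub_sq _ _) y (by simpa using hy)
    have h2 : c < ‖S.s y‖ ^ 2 := hball hyr
    linarith [hs y (gradient (fun z => -N * ‖z - y₀‖ ^ 2) y)]
  refine ⟨?_, by rintro _ ⟨y, rfl⟩; exact hub y⟩
  obtain ⟨y, -, hmax⟩ := (isCompact_closedBall (0 : E) S.M).exists_isMaxOn
    ⟨0, Metric.mem_closedBall_self S.M_pos.le⟩ hw.continuous.continuousOn
  have hglob : ∀ z, w z ≤ w y := fun z => by
    obtain ⟨k, hk, hkM⟩ := S.cover z
    rw [← hw.add_period z k hk]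
    exact hmax (by simpa using hkM)
  -- At a global maximum of `w` a constant is a test function, and the Hamiltonian at `q = 0` is
  -- exactly `|s|²`.
  have h1 := hw.le_ham (fun _ => 0) contDiff_const y (Eventually.of_forall fun z => by
    simpa using hglob z)
  rw [gradient_fun_const, ham, map_zero, zero_add] at h1
  exact ⟨y, le_antisymm (hub y) h1⟩

/-- Classical solutions are viscosity solutions. -/
theorem isCellSolution_of_hasGradientAt {c : ℝ} {w : E → ℝ} {w' : E → E}
    (hw : ∀ x, HasGradientAt w (w' x) x) (hp : ∀ x, ∀ k ∈ S.P, w (x + k) = w x)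
    (hc : ∀ x, S.ham x (w' x) = c) : S.IsCellSolution c w := by
  have key : ∀ φ : E → ℝ, ContDiff ℝ 1 φ → ∀ y,
      IsLocalExtr (fun z => w z - φ z) y → S.ham y (gradient φ y) = c := by
    intro φ hφ y hy
    have h1 := ((hφ.differentiable one_ne_zero) y).hasGradientAt
    have h2 := ((hw y).hasFDerivAt.sub h1.hasFDerivAt)
    have h3 := hy.hasFDerivAt_eq_zero h2
    rw [← map_sub, LinearIsometryEquiv.map_eq_zero_iff, sub_eq_zero] at h3
    rw [← h3, hc]
  exact ⟨continuous_iff_continuousAt.2 fun x => (hw x).hasFDerivAt.continuousAt, hp,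
    fun φ hφ y hy => (key φ hφ y (Or.inr hy)).ge, fun φ hφ y hy => (key φ hφ y (Or.inl hy)).le⟩

end PeriodicSystem

/-! ### Upper bound: verification along arbitrary paths -/

namespace PeriodicSystem

variable {E G : Type*} [NormedAddCommGroup E] [InnerProductSpace ℝ E] [FiniteDimensional ℝ E]
    [NormedAddCommGroup G] [InnerProductSpace ℝ G] [FiniteDimensional ℝ G]
    {S : PeriodicSystem E G}

/-- Trajectories for a locally square integrable control `α`. -/
structure IsPath (S : PeriodicSystem E G) (y₀ : E) (α : ℝ → G) (y : ℝ → E) : Prop where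
  continuous : Continuous y
  measurable : AEStronglyMeasurable α volume
  sq_integrable : ∀ a b, 0 ≤ a → a ≤ b → IntervalIntegrable (fun t => ‖α t‖ ^ 2) volume a b
  eq : ∀ t, 0 ≤ t → y t = y₀ + ∫ r in (0 : ℝ)..t, (2 : ℝ) • S.A (y r) (α r)

namespace IsPath

variable {y₀ : E} {α : ℝ → G} {y : ℝ → E} (hp : S.IsPath y₀ α y) {a b : ℝ} (ha : 0 ≤ a)
  (hab : a ≤ b)
include hp ha hab

omit [FiniteDimensional ℝ E] [FiniteDimensional ℝ G] in
theorem intervalIntegrable : IntervalIntegrable α volume a b := by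
  refine ((hp.sq_integrable a b ha hab).add (intervalIntegrable_const (c := (1 : ℝ)))).mono_fun
    hp.measurable.restrict (Eventually.of_forall fun t => ?_)
  simp only [Real.norm_eq_abs]
  exact le_trans (by nlinarith [sq_nonneg (‖α t‖ - 1)]) (le_abs_self _)

omit [FiniteDimensional ℝ E] [FiniteDimensional ℝ G] in
theorem intervalIntegrable_clm {F : Type*} [NormedAddCommGroup F] [NormedSpace ℝ F]
    {B : E → G →L[ℝ] F} (hB : Continuous B) {C : ℝ} (hC : ∀ x, ‖B x‖ ≤ C) :
    IntervalIntegrable (fun t => B (y t) (α t)) volume a b := by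
  refine ((hp.intervalIntegrable ha hab).norm.const_mul C).mono_fun ?_
    (Eventually.of_forall fun t => ?_)
  · have h1 : AEStronglyMeasurable (fun t => (B (y t), α t)) volume :=
      (hB.comp hp.continuous).aestronglyMeasurable.prodMk hp.measurable
    have h2 : Continuous fun p : (G →L[ℝ] F) × G => p.1 p.2 := by fun_prop
    exact (h2.comp_aestronglyMeasurable h1).restrict
  · exact ((B (y t)).le_of_opNorm_le (hC _) _).trans (le_abs_self _)

theorem intervalIntegrable_A :
    IntervalIntegrable (fun t => S.A (y t) (α t)) volume a b :=
  hp.intervalIntegrable_clm ha hab S.continuous_A S.norm_A_le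

theorem intervalIntegrable_inner :
    IntervalIntegrable (fun t => inner ℝ (S.s (y t)) (α t)) volume a b := by
  have := hp.intervalIntegrable_clm ha hab (B := fun x => innerSL ℝ (S.s x))
    ((innerSL ℝ).continuous.comp S.continuous_s) (C := S.M)
    (fun x => by rw [innerSL_apply_norm]; exact S.norm_s_le x)
  simpa using this

theorem intervalIntegrable_reward :
    IntervalIntegrable (fun t => S.reward (y t) (α t)) volume a b := by
  unfold reward
  exact ((hp.intervalIntegrable_inner ha hab).const_mul 2).sub (hp.sq_integrable a b ha hab)

theorem sub_eq : y b - y a = (2 : ℝ) • ∫ r in a..b, S.A (y r) (α r) := by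
  rw [hp.eq b (ha.trans hab), hp.eq a ha, intervalIntegral.integral_smul,
    intervalIntegral.integral_smul, add_sub_add_left_eq_sub, ← smul_sub,
    intervalIntegral.integral_interval_sub_left (hp.intervalIntegrable_A le_rfl (ha.trans hab))
      (hp.intervalIntegrable_A le_rfl ha)]

theorem norm_sub_le : ‖y b - y a‖ ≤ 2 * S.M * ∫ r in a..b, ‖α r‖ := by
  rw [hp.sub_eq ha hab, norm_smul, Real.norm_two, mul_assoc,
    ← intervalIntegral.integral_const_mul]
  gcongr
  refine (intervalIntegral.norm_integral_le_integral_norm hab).trans ?_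
  exact intervalIntegral.integral_mono_on hab (hp.intervalIntegrable_A ha hab).norm
    ((hp.intervalIntegrable ha hab).norm.const_mul _) fun t _ => S.norm_A_apply_le _ _

omit [FiniteDimensional ℝ E] [FiniteDimensional ℝ G] hab in
theorem sq_integral_le {h : ℝ} (h0 : 0 < h) :
    (∫ r in a..(a + h), ‖α r‖) ^ 2 ≤ h * ∫ r in a..(a + h), ‖α r‖ ^ 2 := by
  have hab : a ≤ a + h := by linarith
  set I := ∫ r in a..(a + h), ‖α r‖ with hI
  set J := ∫ r in a..(a + h), ‖α r‖ ^ 2 with hJ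
  have i1 := (hp.intervalIntegrable ha hab).norm
  have i2 := hp.sq_integrable a (a + h) ha hab
  -- Cauchy–Schwarz, by integrating the nonnegative function `(h‖α‖ - I)² / h`.
  have h1 : 0 ≤ ∫ r in a..(a + h), (h * ‖α r‖ ^ 2 - 2 * I * ‖α r‖ + I ^ 2 / h) := by
    refine intervalIntegral.integral_nonneg hab fun t _ => ?_
    have : h * ‖α t‖ ^ 2 - 2 * I * ‖α t‖ + I ^ 2 / h = (h * ‖α t‖ - I) ^ 2 / h := by
      field_simp
      ring
    rw [this]; positivity
  rw [intervalIntegral.integral_add ((i2.const_mul h).sub (i1.const_mul _))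
    intervalIntegrable_const, intervalIntegral.integral_sub (i2.const_mul h) (i1.const_mul _),
    intervalIntegral.integral_const_mul, intervalIntegral.integral_const_mul,
    intervalIntegral.integral_const, ← hI, ← hJ, add_sub_cancel_left, smul_eq_mul,
    mul_div_cancel₀ _ h0.ne'] at h1
  linarith

/-- One step of the verification argument. -/
theorem step_le {h K c : ℝ} {w : E → ℝ} (h0 : 0 < h) (hK : 0 < K)
    (hw : S.IsSchemeSolution h K c w) (hbe : b = a + h) :
    w (y b) + ∫ t in a..b, S.reward (y t) (α t) ≤ w (y a) + h * c + K * h ^ 2 +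
      (K + 1) * (4 * S.M ^ 2) * h * ∫ t in a..b, ‖α t‖ ^ 2 := by
  subst hbe
  have hM := S.M_pos
  have hCS := hp.sq_integral_le ha h0
  set b := a + h with hb
  set I := ∫ r in a..b, ‖α r‖ with hI
  set J := ∫ r in a..b, ‖α r‖ ^ 2 with hJ
  have i0 := hp.intervalIntegrable ha hab
  have hI0 : 0 ≤ I := intervalIntegral.integral_nonneg hab fun t _ => norm_nonneg _
  have hclose : ∀ t ∈ Icc a b, ‖y t - y a‖ ≤ 2 * S.M * I := fun t ht => by
    refine (hp.norm_sub_le ha ht.1).trans ?_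
    gcongr
    exact intervalIntegral.integral_mono_interval le_rfl ht.1 ht.2
      (Eventually.of_forall fun _ => norm_nonneg _) i0.norm
  set V := ∫ r in a..b, α r with hV
  have hVI : ‖V‖ ≤ I := intervalIntegral.norm_integral_le_integral_norm hab
  -- The path is compared with one Euler step using the mean control. Over the step `A` and `s` vary
  -- by at most `2M²I`, so the endpoint and the linear part of the reward are off by `O(I²)`, which
  -- is `O(hJ)`. The quadratic part of the reward only helps, because `‖V‖² / h ≤ J`.
  set β : G := (1 / h) • V with hβ
  have e1 : S.euler h (y a) β = y a + (2 : ℝ) • S.A (y a) V := by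
    rw [euler, hβ, map_smul, smul_smul]; congr 2; field_simp
  have e2 : y b - S.euler h (y a) β = (2 : ℝ) • ∫ t in a..b, (S.A (y t) (α t) - S.A (y a) (α t)) := by
    rw [intervalIntegral.integral_sub (hp.intervalIntegrable_A ha hab)
      (hp.intervalIntegrable_clm ha hab (B := fun _ => S.A (y a)) continuous_const
        (fun _ => le_rfl)), ContinuousLinearMap.intervalIntegral_comp_comm _ i0, ← hV, smul_sub,
        ← hp.sub_eq ha hab, e1]
    abel
  have e3 : ‖y b - S.euler h (y a) β‖ ≤ 4 * S.M ^ 2 * I ^ 2 := by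
    rw [e2, norm_smul, Real.norm_two]
    have : ‖∫ t in a..b, (S.A (y t) (α t) - S.A (y a) (α t))‖ ≤
        ∫ t in a..b, S.M * (2 * S.M * I) * ‖α t‖ := by
      refine intervalIntegral.norm_integral_le_of_norm_le hab ?_ (i0.norm.const_mul _)
      refine Eventually.of_forall fun t ht => ?_
      refine (S.norm_A_sub_apply_le _ _ _).trans ?_
      gcongr
      exact hclose t (Ioc_subset_Icc_self ht)
    rw [intervalIntegral.integral_const_mul] at this
    calc _ ≤ 2 * (S.M * (2 * S.M * I) * I) := by gcongr
      _ = _ := by ring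
  have e4 : ∫ t in a..b, S.reward (y t) (α t) ≤ h * S.reward (y a) β + 4 * S.M ^ 2 * I ^ 2 := by
    have j1 : ∫ t in a..b, S.reward (y t) (α t) ≤
        ∫ t in a..b, (2 * inner ℝ (S.s (y a)) (α t) + 4 * S.M ^ 2 * I * ‖α t‖ - ‖α t‖ ^ 2) := by
      have i2 : IntervalIntegrable (fun t => inner ℝ (S.s (y a)) (α t)) volume a b := by
        have := hp.intervalIntegrable_clm ha hab (B := fun _ => innerSL ℝ (S.s (y a)))
          continuous_const (fun _ => le_rfl)
        simpa using this
      refine intervalIntegral.integral_mono_on hab (hp.intervalIntegrable_reward ha hab)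
        (((i2.const_mul 2).add (i0.norm.const_mul _)).sub (hp.sq_integrable a b ha hab))
        fun t ht => ?_
      have k1 : inner ℝ (S.s (y t) - S.s (y a)) (α t) ≤ S.M * (2 * S.M * I) * ‖α t‖ := by
        refine (real_inner_le_norm _ _).trans ?_
        gcongr
        exact (S.s_lip _ _).trans (by gcongr; exact hclose t ht)
      rw [inner_sub_left] at k1
      unfold reward
      linarith
    have i2 : IntervalIntegrable (fun t => inner ℝ (S.s (y a)) (α t)) volume a b := by
      have := hp.intervalIntegrable_clm ha hab (B := fun _ => innerSL ℝ (S.s (y a)))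
        continuous_const (fun _ => le_rfl)
      simpa using this
    rw [intervalIntegral.integral_sub ((i2.const_mul 2).add (i0.norm.const_mul _))
      (hp.sq_integrable a b ha hab), intervalIntegral.integral_add (i2.const_mul 2)
      (i0.norm.const_mul _), intervalIntegral.integral_const_mul,
      intervalIntegral.integral_const_mul] at j1
    have j2 : ∫ t in a..b, inner ℝ (S.s (y a)) (α t) = inner ℝ (S.s (y a)) V := by
      have := ContinuousLinearMap.intervalIntegral_comp_comm (innerSL ℝ (S.s (y a))) i0
      simpa using this
    have j3 : h * S.reward (y a) β = 2 * inner ℝ (S.s (y a)) V - ‖V‖ ^ 2 / h := by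
      rw [reward, hβ, inner_smul_right, norm_smul, Real.norm_of_nonneg (by positivity)]
      field_simp
    have j4 : ‖V‖ ^ 2 / h ≤ J := by
      rw [div_le_iff₀ h0]
      have : ‖V‖ ^ 2 ≤ I ^ 2 := by gcongr
      linarith
    rw [j2, ← hI, ← hJ] at j1
    rw [j3]
    linarith
  have e5 := hw.super (y a) β
  have e6 := hw.lip (S.euler h (y a) β) (y b)
  have e7 : K * ‖y b - S.euler h (y a) β‖ ≤ K * (4 * S.M ^ 2 * I ^ 2) := by gcongr
  have e8 : (K + 1) * (4 * S.M ^ 2) * I ^ 2 ≤ (K + 1) * (4 * S.M ^ 2) * (h * J) := by gcongr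
  linarith

omit ha hab in
theorem integral_mul_le {h K c : ℝ} {w : E → ℝ} (h0 : 0 < h) (hK : 0 < K)
    (hw : S.IsSchemeSolution h K c w) (N : ℕ) :
    w (y (N * h)) + ∫ t in (0 : ℝ)..(N * h), S.reward (y t) (α t) ≤ w (y 0) + N * h * c +
      N * K * h ^ 2 + (K + 1) * (4 * S.M ^ 2) * h * ∫ t in (0 : ℝ)..(N * h), ‖α t‖ ^ 2 := by
  induction N with
  | zero => simp
  | succ N ih =>
    have hN : 0 ≤ (N : ℝ) * h := by positivity
    have hN' : (N : ℝ) * h ≤ ((N + 1 : ℕ) : ℝ) * h := by push_cast; linarith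
    have h1 := hp.step_le hN hN' h0 hK hw (by push_cast; ring)
    rw [← intervalIntegral.integral_add_adjacent_intervals
      (hp.intervalIntegrable_reward le_rfl hN) (hp.intervalIntegrable_reward hN hN'),
      ← intervalIntegral.integral_add_adjacent_intervals (hp.sq_integrable _ _ le_rfl hN)
      (hp.sq_integrable _ _ hN hN')]
    rw [mul_add]
    push_cast at *
    linarith

omit ha hab in
theorem integral_reward_le_of_scheme {h K c T : ℝ} {w : E → ℝ} (h0 : 0 < h) (hK : 0 < K)
    (hw : S.IsSchemeSolution h K c w) (hT : 0 ≤ T) :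
    ∫ t in (0 : ℝ)..T, S.reward (y t) (α t) ≤ c * T + 2 * K +
      h * (K * T + (K + 1) * (4 * S.M ^ 2) * (∫ t in (0 : ℝ)..T, ‖α t‖ ^ 2) + S.M ^ 2) := by
  set N := ⌊T / h⌋₊
  have hN1 : (N : ℝ) * h ≤ T := by
    have := Nat.floor_le (show 0 ≤ T / h by positivity)
    rwa [le_div_iff₀ h0] at this
  have hN2 : T ≤ (N : ℝ) * h + h := by
    have := (Nat.lt_floor_add_one (T / h)).le
    rw [div_le_iff₀ h0] at this
    change T ≤ ((N : ℝ) + 1) * h at this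
    linarith
  have hN0 : 0 ≤ (N : ℝ) * h := by positivity
  have h1 := hp.integral_mul_le h0 hK hw N
  have h2 : ∫ t in (N * h : ℝ)..T, S.reward (y t) (α t) ≤ S.M ^ 2 * h := by
    calc _ ≤ ∫ t in (N * h : ℝ)..T, S.M ^ 2 :=
          intervalIntegral.integral_mono_on hN1 (hp.intervalIntegrable_reward hN0 hN1)
            intervalIntegrable_const fun t _ => S.reward_le _ _
      _ = (T - N * h) * S.M ^ 2 := by rw [intervalIntegral.integral_const, smul_eq_mul]
      _ ≤ h * S.M ^ 2 := by gcongr; linarith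
      _ = _ := by ring
  have h3 : ∫ t in (0 : ℝ)..(N * h), ‖α t‖ ^ 2 ≤ ∫ t in (0 : ℝ)..T, ‖α t‖ ^ 2 :=
    intervalIntegral.integral_mono_interval le_rfl hN0 hN1
      (Eventually.of_forall fun _ => sq_nonneg _) (hp.sq_integrable 0 T le_rfl hT)
  have h4 : (K + 1) * (4 * S.M ^ 2) * h * ∫ t in (0 : ℝ)..(N * h), ‖α t‖ ^ 2 ≤
      (K + 1) * (4 * S.M ^ 2) * h * ∫ t in (0 : ℝ)..T, ‖α t‖ ^ 2 := by gcongr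
  have h5 : N * h * c ≤ T * c := mul_le_mul_of_nonneg_right hN1 hw.nonneg
  have h6 : N * h * (K * h) ≤ T * (K * h) := by gcongr
  have h7 := _root_.abs_le.1 (hw.abs_le (y 0))
  have h8 := _root_.abs_le.1 (hw.abs_le (y (N * h)))
  rw [← intervalIntegral.integral_add_adjacent_intervals
      (hp.intervalIntegrable_reward le_rfl hN0) (hp.intervalIntegrable_reward hN0 hN1)]
  linarith

end IsPath

/-- For a fixed path and horizon the verification error is `h` times a finite quantity that contains
`∫‖α‖²`. Letting `h → 0` removes it and leaves only the oscillation of the scheme solutions, bounded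
independently of `T` and of the path. -/
theorem IsPath.integral_reward_le {c : ℝ}
    (hc : ∀ ε > 0, ∃ h, 0 < h ∧ h ≤ 1 ∧ h ≤ ε ∧ ∃ c₁ w₁, |c₁ - c| ≤ ε ∧
      S.IsSchemeSolution h S.schemeBound c₁ w₁)
    {y₀ : E} {α : ℝ → G} {y : ℝ → E} (hp : S.IsPath y₀ α y) {T : ℝ} (hT : 0 ≤ T) :
    ∫ t in (0 : ℝ)..T, S.reward (y t) (α t) ≤ c * T + 2 * S.schemeBound := by
  have hK : 0 < S.schemeBound := one_pos.trans_le S.one_le_schemeBound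
  set K := S.schemeBound
  set J := ∫ t in (0 : ℝ)..T, ‖α t‖ ^ 2
  have hJ : 0 ≤ J := intervalIntegral.integral_nonneg hT fun _ _ => sq_nonneg _
  have key : ∀ ε > 0, ∫ t in (0 : ℝ)..T, S.reward (y t) (α t) ≤ c * T + 2 * K +
      ε * (T + (K * T + (K + 1) * (4 * S.M ^ 2) * J + S.M ^ 2)) := fun ε hε => by
    obtain ⟨h, h0, -, hε', c₁, w₁, hc₁, hw⟩ := hc ε hε
    have h1 := hp.integral_reward_le_of_scheme h0 hK hw hT
    have h2 : c₁ * T ≤ (c + ε) * T := by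
      gcongr; linarith [(abs_le.1 hc₁).2]
    have h3 : h * (K * T + (K + 1) * (4 * S.M ^ 2) * J + S.M ^ 2) ≤
        ε * (K * T + (K + 1) * (4 * S.M ^ 2) * J + S.M ^ 2) := by gcongr
    linarith
  set Z := T + (K * T + (K + 1) * (4 * S.M ^ 2) * J + S.M ^ 2)
  have hZ : 0 < Z := by
    have := S.M_pos
    positivity
  refine le_of_forall_pos_le_add fun ε hε => ?_
  have := key (ε / Z) (by positivity)
  rwa [div_mul_cancel₀ _ hZ.ne'] at this

end PeriodicSystem

/-! ### Lower bound: polygons through nearly optimal Euler chains -/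

namespace PeriodicSystem

variable {E G : Type*} [NormedAddCommGroup E] [InnerProductSpace ℝ E] [FiniteDimensional ℝ E]
    [NormedAddCommGroup G] [InnerProductSpace ℝ G] [FiniteDimensional ℝ G]
    (S : PeriodicSystem E G)

/-- The Euler chain that starts from `x` and follows the feedback `a`. -/
noncomputable def chain (h : ℝ) (a : E → G) (x : E) : ℕ → E
  | 0 => x
  | j + 1 => S.euler h (chain h a x j) (a (chain h a x j))

/-- The piecewise constant velocity of the polygon through the points of the Euler chain. -/
noncomputable def polyVel (h : ℝ) (a : E → G) (x : E) (t : ℝ) : E :=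
  (2 : ℝ) • S.A (S.chain h a x ⌊t / h⌋₊) (a (S.chain h a x ⌊t / h⌋₊))

/-- The polygon through the points of the Euler chain. -/
noncomputable def poly (h : ℝ) (a : E → G) (x : E) (t : ℝ) : E :=
  x + ∫ r in (0 : ℝ)..t, S.polyVel h a x r

/-- The control that follows the polygon. -/
noncomputable def polyControl (h : ℝ) (a : E → G) (x : E) (t : ℝ) : G :=
  a (S.chain h a x ⌊t / h⌋₊) + S.R (S.poly h a x t)
    (S.A (S.chain h a x ⌊t / h⌋₊) (a (S.chain h a x ⌊t / h⌋₊)) -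
      S.A (S.poly h a x t) (a (S.chain h a x ⌊t / h⌋₊)))

-- The `R` term compensates for evaluating `A` on the polygon instead of at the last node, so the
-- polygon is an exact trajectory.
omit [FiniteDimensional ℝ E] [FiniteDimensional ℝ G] in
theorem A_polyControl (h : ℝ) (a : E → G) (x : E) (t : ℝ) :
    (2 : ℝ) • S.A (S.poly h a x t) (S.polyControl h a x t) = S.polyVel h a x t := by
  rw [polyControl, map_add, S.A_R, polyVel]; congr 1; abel

theorem stronglyMeasurable_comp_floor {F : Type*} [TopologicalSpace F]
    (f : ℕ → F) (h : ℝ) : StronglyMeasurable fun t : ℝ => f ⌊t / h⌋₊ :=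
  (StronglyMeasurable.of_discrete (f := f)).comp_measurable
    (Nat.measurable_floor.comp (measurable_id.div_const h))

section

variable {h : ℝ} {a : E → G} {B : ℝ} (ha : ∀ x, ‖a x‖ ≤ B)
include ha

omit [FiniteDimensional ℝ E] [FiniteDimensional ℝ G] in
theorem norm_polyVel_le (x : E) (t : ℝ) : ‖S.polyVel h a x t‖ ≤ 2 * (S.M * B) := by
  rw [polyVel, norm_smul, Real.norm_two]
  gcongr
  exact (S.norm_A_apply_le _ _).trans (mul_le_mul_of_nonneg_left (ha _) S.M_pos.le)

omit [FiniteDimensional ℝ E] [FiniteDimensional ℝ G] in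
theorem intervalIntegrable_polyVel (x : E) (t₁ t₂ : ℝ) :
    IntervalIntegrable (S.polyVel h a x) volume t₁ t₂ := by
  refine (intervalIntegrable_const (c := 2 * (S.M * B))).mono_fun
    (stronglyMeasurable_comp_floor
      (fun j => (2 : ℝ) • S.A (S.chain h a x j) (a (S.chain h a x j))) h).aestronglyMeasurable
    (Eventually.of_forall fun t => (S.norm_polyVel_le ha x t).trans (le_abs_self _))

theorem norm_poly_sub_le (x : E) (t₁ t₂ : ℝ) :
    ‖S.poly h a x t₂ - S.poly h a x t₁‖ ≤ 2 * (S.M * B) * |t₂ - t₁| := by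
  rw [poly, poly, add_sub_add_left_eq_sub, intervalIntegral.integral_interval_sub_left
    (S.intervalIntegrable_polyVel ha x _ _) (S.intervalIntegrable_polyVel ha x _ _)]
  exact intervalIntegral.norm_integral_le_of_norm_le_const fun t _ => S.norm_polyVel_le ha x t

theorem continuous_poly (x : E) : Continuous (S.poly h a x) :=
  continuous_const.add (intervalIntegral.continuous_primitive
    (fun t₁ t₂ => S.intervalIntegrable_polyVel ha x t₁ t₂) 0)

theorem poly_mul (h0 : 0 < h) (x : E) (j : ℕ) : S.poly h a x (j * h) = S.chain h a x j := by
  induction j with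
  | zero => simp [poly, chain]
  | succ j ih =>
    have hle : (j : ℝ) * h ≤ ((j + 1 : ℕ) : ℝ) * h := by push_cast; linarith
    have e : ∫ t in (j * h : ℝ)..((j + 1 : ℕ) * h), S.polyVel h a x t =
        ∫ t in (j * h : ℝ)..((j + 1 : ℕ) * h),
          (2 : ℝ) • S.A (S.chain h a x j) (a (S.chain h a x j)) := by
      -- The floor is constant on intervals closed on the left, hence the passage from `Ioc` to
      -- `Ico`.
      rw [intervalIntegral.integral_of_le hle, intervalIntegral.integral_of_le hle,
        ← integral_Ico_eq_integral_Ioc, ← integral_Ico_eq_integral_Ioc]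
      refine setIntegral_congr_fun measurableSet_Ico fun t ht => ?_
      have : ⌊t / h⌋₊ = j := by
        rw [Nat.floor_eq_iff (by have := ht.1; have : 0 ≤ (j : ℝ) * h := by positivity
                                 exact div_nonneg (this.trans ht.1) h0.le),
          le_div_iff₀ h0, div_lt_iff₀ h0]
        exact ⟨ht.1, by have := ht.2; push_cast at this; exact this⟩
      simp only [polyVel, this]
    have e2 : S.poly h a x ((j + 1 : ℕ) * h) = S.poly h a x (j * h) +
        ∫ t in (j * h : ℝ)..((j + 1 : ℕ) * h), S.polyVel h a x t := by
      rw [poly, poly, add_assoc, intervalIntegral.integral_add_adjacent_intervals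
        (S.intervalIntegrable_polyVel ha x _ _) (S.intervalIntegrable_polyVel ha x _ _)]
    rw [e2, e, ih, intervalIntegral.integral_const, chain, euler, smul_smul]
    push_cast
    congr 2
    ring

omit ha in
theorem floor_mul_le (h0 : 0 < h) {t : ℝ} (ht : 0 ≤ t) : (⌊t / h⌋₊ : ℝ) * h ≤ t := by
  have := Nat.floor_le (show 0 ≤ t / h by positivity)
  rwa [le_div_iff₀ h0] at this

omit ha in
theorem le_floor_mul_add (h0 : 0 < h) (t : ℝ) : t ≤ (⌊t / h⌋₊ : ℝ) * h + h := by
  have := (Nat.lt_floor_add_one (t / h)).le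
  rw [div_le_iff₀ h0] at this
  linarith

theorem norm_chain_sub_poly_le (h0 : 0 < h) (x : E) {t : ℝ} (ht : 0 ≤ t) :
    ‖S.chain h a x ⌊t / h⌋₊ - S.poly h a x t‖ ≤ 2 * (S.M * B) * h := by
  have hB : 0 ≤ B := (norm_nonneg _).trans (ha 0)
  have hM := S.M_pos
  rw [← S.poly_mul ha h0]
  refine (S.norm_poly_sub_le ha x _ _).trans ?_
  gcongr
  rw [abs_le]
  constructor <;> linarith [floor_mul_le h0 ht, le_floor_mul_add h0 t]

theorem norm_polyControl_sub_le (h0 : 0 < h) (x : E) {t : ℝ} (ht : 0 ≤ t) :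
    ‖S.polyControl h a x t - a (S.chain h a x ⌊t / h⌋₊)‖ ≤ 2 * S.M ^ 3 * B ^ 2 * h := by
  have hB : 0 ≤ B := (norm_nonneg _).trans (ha 0)
  have hM := S.M_pos
  rw [polyControl, add_sub_cancel_left]
  refine (S.norm_R_apply_le _ _).trans ?_
  calc _ ≤ S.M * (S.M * (2 * (S.M * B) * h) * B) := by
        gcongr
        refine (S.norm_A_sub_apply_le _ _ _).trans ?_
        gcongr
        · exact S.norm_chain_sub_poly_le ha h0 x ht
        · exact ha _
    _ = _ := by ring

theorem norm_polyControl_le (h0 : 0 < h) (h1 : h ≤ 1) (x : E) {t : ℝ} (ht : 0 ≤ t) :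
    ‖S.polyControl h a x t‖ ≤ B + 2 * S.M ^ 3 * B ^ 2 := by
  have hB : 0 ≤ B := (norm_nonneg _).trans (ha 0)
  have hM := S.M_pos
  have h2 := S.norm_polyControl_sub_le ha h0 x ht
  have h3 := norm_le_norm_add_norm_sub' (S.polyControl h a x t) (a (S.chain h a x ⌊t / h⌋₊))
  have h4 : 2 * S.M ^ 3 * B ^ 2 * h ≤ 2 * S.M ^ 3 * B ^ 2 :=
    mul_le_of_le_one_right (by positivity) h1
  linarith [ha (S.chain h a x ⌊t / h⌋₊)]

theorem stronglyMeasurable_polyControl (x : E) : StronglyMeasurable (S.polyControl h a x) := by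
  have hc := S.continuous_poly (h := h) ha x
  have m1 := stronglyMeasurable_comp_floor (fun j => a (S.chain h a x j)) h
  have m2 := stronglyMeasurable_comp_floor
    (fun j => S.A (S.chain h a x j) (a (S.chain h a x j))) h
  have m3 : StronglyMeasurable fun t => S.A (S.poly h a x t) (a (S.chain h a x ⌊t / h⌋₊)) :=
    (show Continuous fun p : (G →L[ℝ] E) × G => p.1 p.2 by fun_prop).comp_stronglyMeasurable
      ((S.continuous_A.comp hc).stronglyMeasurable.prodMk m1)
  exact m1.add ((show Continuous fun p : (E →L[ℝ] G) × E => p.1 p.2 by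
    fun_prop).comp_stronglyMeasurable ((S.continuous_R.comp hc).stronglyMeasurable.prodMk
      (m2.sub m3)))

theorem isPath_poly (h0 : 0 < h) (h1 : h ≤ 1) (x : E) :
    S.IsPath x (S.polyControl h a x) (S.poly h a x) where
  continuous := S.continuous_poly ha x
  measurable := (S.stronglyMeasurable_polyControl ha x).aestronglyMeasurable
  sq_integrable t₁ t₂ ht₁ ht := by
    have hB : 0 ≤ B := (norm_nonneg _).trans (ha 0)
    have hM := S.M_pos
    refine (intervalIntegrable_const (c := (B + 2 * S.M ^ 3 * B ^ 2) ^ 2)).mono_fun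
      ((S.stronglyMeasurable_polyControl ha x).norm.pow 2).aestronglyMeasurable ?_
    refine (ae_restrict_iff' measurableSet_uIoc).2 (Eventually.of_forall fun t ht' => ?_)
    rw [uIoc_of_le ht] at ht'
    refine le_trans ?_ (le_abs_self _)
    change ‖‖S.polyControl h a x t‖ ^ 2‖ ≤ _
    rw [Real.norm_of_nonneg (sq_nonneg _)]
    gcongr
    exact S.norm_polyControl_le ha h0 h1 x (ht₁.trans ht'.1.le)
  eq t _ := by
    simp only [A_polyControl]
    rfl

/-- The loss of reward per unit of step when the Euler chain is replaced by the polygon. -/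
noncomputable def polyLoss (S : PeriodicSystem E G) (B : ℝ) : ℝ :=
  2 * S.M * (2 * (S.M * B)) * B + 2 * S.M ^ 3 * B ^ 2 * (2 * S.M + 2 * B + 2 * S.M ^ 3 * B ^ 2)

theorem le_reward_poly (h0 : 0 < h) (h1 : h ≤ 1) (x : E) {t : ℝ} (ht : 0 ≤ t) :
    S.reward (S.chain h a x ⌊t / h⌋₊) (a (S.chain h a x ⌊t / h⌋₊)) - S.polyLoss B * h ≤
      S.reward (S.poly h a x t) (S.polyControl h a x t) := by
  have hB : 0 ≤ B := (norm_nonneg _).trans (ha 0)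
  have hM := S.M_pos
  have k1 := S.reward_sub_le (S.chain h a x ⌊t / h⌋₊) (S.poly h a x t)
    (a (S.chain h a x ⌊t / h⌋₊)) (S.polyControl h a x t)
  have k2 := S.norm_chain_sub_poly_le ha h0 x ht
  have k3 := S.norm_polyControl_sub_le ha h0 x ht
  have k4 : ‖S.polyControl h a x t - a (S.chain h a x ⌊t / h⌋₊)‖ ≤ 2 * S.M ^ 3 * B ^ 2 :=
    k3.trans (mul_le_of_le_one_right (by positivity) h1)
  have k5 := ha (S.chain h a x ⌊t / h⌋₊)
  have k6 : 2 * S.M * ‖S.chain h a x ⌊t / h⌋₊ - S.poly h a x t‖ * ‖a (S.chain h a x ⌊t / h⌋₊)‖ +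
      ‖S.polyControl h a x t - a (S.chain h a x ⌊t / h⌋₊)‖ * (2 * S.M +
        2 * ‖a (S.chain h a x ⌊t / h⌋₊)‖ +
        ‖S.polyControl h a x t - a (S.chain h a x ⌊t / h⌋₊)‖) ≤
      2 * S.M * (2 * (S.M * B) * h) * B + 2 * S.M ^ 3 * B ^ 2 * h *
        (2 * S.M + 2 * B + 2 * S.M ^ 3 * B ^ 2) := by gcongr
  have e : S.polyLoss B * h = 2 * S.M * (2 * (S.M * B) * h) * B + 2 * S.M ^ 3 * B ^ 2 * h *
        (2 * S.M + 2 * B + 2 * S.M ^ 3 * B ^ 2) := by unfold polyLoss; ring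
  linarith

/-- The scheme inequality telescopes along the chain. Each step loses `B h²` from the scheme and
`polyLoss B * h²` from the passage to the polygon. -/
theorem le_integral_mul {c : ℝ} {w : E → ℝ} (h0 : 0 < h) (h1 : h ≤ 1)
    (hw : ∀ x, w x ≤ w (S.euler h x (a x)) + h * (S.reward x (a x) - c) + B * h ^ 2)
    (x : E) (N : ℕ) :
    w x + N * h * c - N * (B + S.polyLoss B) * h ^ 2 ≤ w (S.chain h a x N) +
      ∫ t in (0 : ℝ)..(N * h), S.reward (S.poly h a x t) (S.polyControl h a x t) := by
  have hp := S.isPath_poly ha h0 h1 x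
  induction N with
  | zero => simp [chain]
  | succ N ih =>
    have hN : 0 ≤ (N : ℝ) * h := by positivity
    have hN' : (N : ℝ) * h ≤ ((N + 1 : ℕ) : ℝ) * h := by push_cast; linarith
    rw [← intervalIntegral.integral_add_adjacent_intervals
      (hp.intervalIntegrable_reward le_rfl hN) (hp.intervalIntegrable_reward hN hN')]
    set X := S.chain h a x N with hX
    have k1 : h * (S.reward X (a X) - S.polyLoss B * h) ≤ ∫ t in (N * h : ℝ)..((N + 1 : ℕ) * h),
        S.reward (S.poly h a x t) (S.polyControl h a x t) := by
      have e : h * (S.reward X (a X) - S.polyLoss B * h) = ∫ t in (N * h : ℝ)..((N + 1 : ℕ) * h),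
          (S.reward X (a X) - S.polyLoss B * h) := by
        rw [intervalIntegral.integral_const, smul_eq_mul]; push_cast; ring
      rw [e]
      refine intervalIntegral.integral_mono_on_of_le_Ioo hN' intervalIntegrable_const
        (hp.intervalIntegrable_reward hN hN') fun t ht => ?_
      have hfl : ⌊t / h⌋₊ = N := by
        rw [Nat.floor_eq_iff (div_nonneg (hN.trans ht.1.le) h0.le), le_div_iff₀ h0,
          div_lt_iff₀ h0]
        exact ⟨ht.1.le, by have := ht.2; push_cast at this; exact this⟩
      have := S.le_reward_poly ha h0 h1 x (hN.trans ht.1.le)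
      rwa [hfl] at this
    have k2 := hw X
    have k3 : S.chain h a x (N + 1) = S.euler h X (a X) := rfl
    rw [k3]
    push_cast at *
    linarith

theorem le_integral_reward_of_scheme {c T : ℝ} {w : E → ℝ} (h0 : 0 < h) (h1 : h ≤ 1)
    (hw : ∀ x, w x ≤ w (S.euler h x (a x)) + h * (S.reward x (a x) - c) + B * h ^ 2)
    (hwB : ∀ x, |w x| ≤ B) (hc : 0 ≤ c) (hcB : c ≤ B) (x : E) (hT : 0 ≤ T) :
    (c - (B + S.polyLoss B) * h) * T - (3 * B + (2 * S.M * (B + 2 * S.M ^ 3 * B ^ 2) +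
      (B + 2 * S.M ^ 3 * B ^ 2) ^ 2)) ≤
      ∫ t in (0 : ℝ)..T, S.reward (S.poly h a x t) (S.polyControl h a x t) := by
  have hp := S.isPath_poly ha h0 h1 x
  have hB : 0 ≤ B := (norm_nonneg _).trans (ha 0)
  have hM := S.M_pos
  have hL : 0 ≤ S.polyLoss B := by unfold polyLoss; positivity
  have hN1 := floor_mul_le h0 hT
  have hN2 := le_floor_mul_add h0 T
  set N := ⌊T / h⌋₊
  have hN0 : 0 ≤ (N : ℝ) * h := by positivity
  set D := 2 * S.M * (B + 2 * S.M ^ 3 * B ^ 2) + (B + 2 * S.M ^ 3 * B ^ 2) ^ 2 with hD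
  have hD0 : 0 ≤ D := by positivity
  have k1 := S.le_integral_mul ha h0 h1 hw x N
  -- The last incomplete step has length at most `h ≤ 1`, so a crude lower bound on the reward costs
  -- at most `D`.
  have k2 : -D ≤ ∫ t in (N * h : ℝ)..T, S.reward (S.poly h a x t) (S.polyControl h a x t) := by
    have e : (T - N * h) * (-D) ≤
        ∫ t in (N * h : ℝ)..T, S.reward (S.poly h a x t) (S.polyControl h a x t) := by
      rw [← smul_eq_mul, ← intervalIntegral.integral_const]
      refine intervalIntegral.integral_mono_on hN1 intervalIntegrable_const
        (hp.intervalIntegrable_reward hN0 hN1) fun t ht => le_trans ?_ (S.le_reward _ _)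
      have := S.norm_polyControl_le ha h0 h1 x (hN0.trans ht.1)
      rw [hD]
      gcongr
    have : (T - N * h) * D ≤ 1 * D := by gcongr; linarith
    linarith
  rw [← intervalIntegral.integral_add_adjacent_intervals
      (hp.intervalIntegrable_reward le_rfl hN0) (hp.intervalIntegrable_reward hN0 hN1)]
  have k3 := abs_le.1 (hwB x)
  have k4 := abs_le.1 (hwB (S.chain h a x N))
  have k5 : c * T ≤ c * (N * h) + B := by
    have : c * T ≤ c * (N * h + h) := by gcongr
    have : c * h ≤ B * 1 := by gcongr
    linarith
  have k6 : (B + S.polyLoss B) * h * (N * h) ≤ (B + S.polyLoss B) * h * T := by gcongr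
  linarith

end

/-- Nearly optimal paths. -/
theorem exists_isPath_le_integral_reward {c : ℝ}
    (hc : ∀ ε > 0, ∃ h, 0 < h ∧ h ≤ 1 ∧ h ≤ ε ∧ ∃ c₁ w₁, |c₁ - c| ≤ ε ∧
      S.IsSchemeSolution h S.schemeBound c₁ w₁) :
    ∃ K', ∀ η > 0, ∀ x, ∃ α y, S.IsPath x α y ∧ StronglyMeasurable α ∧
      ∀ T, 0 ≤ T → (c - η) * T - K' ≤ ∫ t in (0 : ℝ)..T, S.reward (y t) (α t) := by
  have hK : 0 < S.schemeBound := one_pos.trans_le S.one_le_schemeBound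
  have hM := S.M_pos
  set B := S.schemeBound
  have hL : 0 ≤ S.polyLoss B := by unfold polyLoss; positivity
  refine ⟨3 * B + (2 * S.M * (B + 2 * S.M ^ 3 * B ^ 2) +
      (B + 2 * S.M ^ 3 * B ^ 2) ^ 2), fun η hη x => ?_⟩
  -- With `h` and `|c₁ - c|` both at most `η / Z`, the total loss in the growth rate is at most `η`.
  -- The constant chosen above depends neither on `η` nor on `x`.
  set Z := 1 + (B + S.polyLoss B) with hZdef
  have hZ : 0 < Z := by positivity
  obtain ⟨h, h0, h1, hε, c₁, w, hc₁, hw⟩ := hc (η / Z) (by positivity)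
  choose a ha hwa using hw.sub
  refine ⟨_, _, S.isPath_poly ha h0 h1 x, S.stronglyMeasurable_polyControl ha x,
    fun T hT => le_trans ?_ (S.le_integral_reward_of_scheme ha h0 h1 hwa hw.abs_le hw.nonneg
      hw.le x hT)⟩
  gcongr ?_ * T - _
  have e1 := (abs_le.1 hc₁).1
  have e2 : (B + S.polyLoss B) * h ≤ (B + S.polyLoss B) * (η / Z) := by gcongr
  have e3 : η / Z + (B + S.polyLoss B) * (η / Z) = η := by
    rw [hZdef]; field_simp
  linarith

end PeriodicSystem

/-! ### From finite horizons to discounted integrals -/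

section Laplace

variable {δ : ℝ} (hδ : 0 < δ)
include hδ

theorem lintegral_Ioi_ofReal_mul_exp (a : ℝ) :
    ∫⁻ T in Ioi a, ENNReal.ofReal (δ * Real.exp (-δ * T)) = ENNReal.ofReal (Real.exp (-δ * a)) := by
  have h1 : IntegrableOn (fun T => δ * Real.exp (-δ * T)) (Ioi a) :=
    (integrableOn_exp_mul_Ioi (neg_lt_zero.2 hδ) a).const_mul δ
  rw [← ofReal_integral_eq_lintegral_ofReal h1 (Eventually.of_forall fun T => by positivity),
    integral_const_mul, integral_exp_mul_Ioi (neg_lt_zero.2 hδ)]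
  congr 1
  field_simp

/-- The Laplace transform as an average of the integrals over bounded intervals. -/
theorem lintegral_mul_exp_eq {g : ℝ → ENNReal} (hg : Measurable g) :
    ∫⁻ t in Ioi (0 : ℝ), g t * ENNReal.ofReal (Real.exp (-δ * t)) =
      ∫⁻ T in Ioi (0 : ℝ), ENNReal.ofReal (δ * Real.exp (-δ * T)) * ∫⁻ t in Ioo 0 T, g t := by
  -- Tonelli's theorem on `{t < T}`, after writing `e^{-δt}` as the integral of `δ e^{-δT}` over `T
  -- > t`.
  have h1 : ∀ t ∈ Ioi (0 : ℝ), g t * ENNReal.ofReal (Real.exp (-δ * t)) =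
      ∫⁻ T in Ioi (0 : ℝ), (Ioi t).indicator
        (fun T => g t * ENNReal.ofReal (δ * Real.exp (-δ * T))) T := by
    intro t ht
    rw [lintegral_indicator measurableSet_Ioi, Measure.restrict_restrict measurableSet_Ioi,
      inter_eq_left.2 (Ioi_subset_Ioi (le_of_lt ht)),
      lintegral_const_mul _ (by fun_prop), lintegral_Ioi_ofReal_mul_exp hδ]
  have h2 : ∀ T ∈ Ioi (0 : ℝ), ENNReal.ofReal (δ * Real.exp (-δ * T)) * ∫⁻ t in Ioo 0 T, g t =
      ∫⁻ t in Ioi (0 : ℝ), (Ioi t).indicator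
        (fun T => g t * ENNReal.ofReal (δ * Real.exp (-δ * T))) T := by
    intro T hT
    have e : (fun t => (Ioi t).indicator
        (fun T => g t * ENNReal.ofReal (δ * Real.exp (-δ * T))) T) =
        (Iio T).indicator fun t => ENNReal.ofReal (δ * Real.exp (-δ * T)) * g t := by
      ext t
      simp only [indicator, mem_Ioi, mem_Iio, mul_comm]
    rw [e, lintegral_indicator measurableSet_Iio, Measure.restrict_restrict measurableSet_Iio,
      lintegral_const_mul _ hg, inter_comm, Ioi_inter_Iio]
  rw [setLIntegral_congr_fun measurableSet_Ioi h1, setLIntegral_congr_fun measurableSet_Ioi h2]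
  refine lintegral_lintegral_swap (Measurable.aemeasurable ?_)
  have e : (Function.uncurry fun t T : ℝ => (Ioi t).indicator
      (fun T => g t * ENNReal.ofReal (δ * Real.exp (-δ * T))) T) =
      {p : ℝ × ℝ | p.1 < p.2}.indicator
        fun p => g p.1 * ENNReal.ofReal (δ * Real.exp (-δ * p.2)) := by
    ext ⟨t, T⟩
    simp only [Function.uncurry, indicator, mem_Ioi, mem_ofPred_eq]
  rw [e]
  exact Measurable.indicator (by fun_prop) (measurableSet_lt measurable_fst measurable_snd)

/-- The weight `δ e^{-δT}` has total mass one, so a constant uniform in `T` passes through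
unchanged. Multiplied by `δ` in the payoff, it vanishes in the limit. -/
theorem lintegral_mul_exp_le {g g' : ℝ → ENNReal} (hg : Measurable g) (hg' : Measurable g')
    {K : ENNReal} (h : ∀ T > 0, ∫⁻ t in Ioo 0 T, g t ≤ (∫⁻ t in Ioo 0 T, g' t) + K) :
    ∫⁻ t in Ioi (0 : ℝ), g t * ENNReal.ofReal (Real.exp (-δ * t)) ≤
      (∫⁻ t in Ioi (0 : ℝ), g' t * ENNReal.ofReal (Real.exp (-δ * t))) + K := by
  rw [lintegral_mul_exp_eq hδ hg, lintegral_mul_exp_eq hδ hg']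
  have e : K = ∫⁻ T in Ioi (0 : ℝ), ENNReal.ofReal (δ * Real.exp (-δ * T)) * K := by
    rw [lintegral_mul_const _ (by fun_prop), lintegral_Ioi_ofReal_mul_exp hδ]
    simp
  conv_rhs => rw [e]
  rw [← lintegral_add_right _ (by fun_prop)]
  refine setLIntegral_mono' measurableSet_Ioi fun T hT => ?_
  rw [← mul_add]
  gcongr
  exact h T hT

theorem lintegral_add_const_mul_exp {g : ℝ → ENNReal} {a : ℝ} (ha : 0 ≤ a) :
    ∫⁻ t in Ioi (0 : ℝ), (g t + ENNReal.ofReal a) * ENNReal.ofReal (Real.exp (-δ * t)) =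
      (∫⁻ t in Ioi (0 : ℝ), g t * ENNReal.ofReal (Real.exp (-δ * t))) +
        ENNReal.ofReal (a / δ) := by
  simp only [add_mul]
  rw [lintegral_add_right _ (by fun_prop)]
  congr 1
  have : ∀ t, ENNReal.ofReal a * ENNReal.ofReal (Real.exp (-δ * t)) =
      ENNReal.ofReal (a / δ) * ENNReal.ofReal (δ * Real.exp (-δ * t)) := fun t => by
    rw [← ENNReal.ofReal_mul ha, ← ENNReal.ofReal_mul (by positivity)]
    congr 1
    field_simp
  simp only [this]
  rw [lintegral_const_mul _ (by fun_prop), lintegral_Ioi_ofReal_mul_exp hδ]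
  simp

theorem EReal.mul_sub_le_of_le_add {X Y : ENNReal} {a : ℝ} (ha : 0 ≤ a)
    (h : X ≤ Y + ENNReal.ofReal a) : (δ : EReal) * ((X : EReal) - (Y : EReal)) ≤ ((δ * a : ℝ) : EReal) := by
  by_cases hY : Y = ⊤
  · subst hY
    rw [EReal.coe_ennreal_top, EReal.sub_top, EReal.coe_mul_bot_of_pos hδ]
    exact bot_le
  · have hX : X ≠ ⊤ := ne_top_of_le_ne_top (by simp [hY]) h
    have h1 : X.toReal ≤ Y.toReal + a := by
      have := ENNReal.toReal_mono (by simp [hY]) h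
      rwa [ENNReal.toReal_add hY (by simp), ENNReal.toReal_ofReal ha] at this
    rw [← EReal.coe_ennreal_toReal hX, ← EReal.coe_ennreal_toReal hY, ← EReal.coe_sub,
      ← EReal.coe_mul, EReal.coe_le_coe_iff]
    gcongr
    linarith

theorem EReal.le_mul_sub_of_add_le {X Y : ENNReal} {a b : ℝ} (ha : 0 ≤ a) (hb : 0 ≤ b)
    (hX : X ≠ ⊤) (h : Y + ENNReal.ofReal a ≤ X + ENNReal.ofReal b) :
    ((δ * (a - b) : ℝ) : EReal) ≤ (δ : EReal) * ((X : EReal) - (Y : EReal)) := by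
  have hXb : X + ENNReal.ofReal b ≠ ⊤ := by simp [hX]
  have hY : Y ≠ ⊤ := ne_top_of_le_ne_top hXb (le_self_add.trans h)
  have h1 : Y.toReal + a ≤ X.toReal + b := by
    have := ENNReal.toReal_mono hXb h
    rwa [ENNReal.toReal_add hY (by simp), ENNReal.toReal_add hX (by simp),
      ENNReal.toReal_ofReal ha, ENNReal.toReal_ofReal hb] at this
  rw [← EReal.coe_ennreal_toReal hX, ← EReal.coe_ennreal_toReal hY, ← EReal.coe_sub,
    ← EReal.coe_mul, EReal.coe_le_coe_iff]
  exact mul_le_mul_of_nonneg_left (by linarith) hδ.le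

end Laplace

theorem lintegral_Ioo_ofReal_eq {f : ℝ → ℝ} (hf : ∀ t, 0 ≤ f t) {T : ℝ} (hT : 0 ≤ T)
    (hi : IntervalIntegrable f volume 0 T) :
    ∫⁻ t in Ioo 0 T, ENNReal.ofReal (f t) = ENNReal.ofReal (∫ t in (0 : ℝ)..T, f t) := by
  rw [intervalIntegral.integral_of_le hT, integral_Ioc_eq_integral_Ioo,
    ofReal_integral_eq_lintegral_ofReal _ (Eventually.of_forall hf)]
  exact (intervalIntegrable_iff_integrableOn_Ioo_of_le hT).1 hi

/-! ### Discounted payoffs of Carathéodory trajectories -/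

namespace PeriodicSystem

variable {E G : Type*} [NormedAddCommGroup E] [InnerProductSpace ℝ E] [FiniteDimensional ℝ E]
    [NormedAddCommGroup G] [InnerProductSpace ℝ G] [FiniteDimensional ℝ G]
    {S : PeriodicSystem E G}

theorem reward_s_sub (y : E) (b : G) : S.reward y (S.s y - b) = ‖S.s y‖ ^ 2 - ‖b‖ ^ 2 := by
  rw [reward, norm_sub_sq_real, inner_sub_right, real_inner_self_eq_norm_sq]; ring

section

variable {y₀ : E} {α : ℝ → G} {y : ℝ → E} (hp : S.IsPath y₀ α y) {T : ℝ} (hT : 0 ≤ T)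
include hp hT

theorem IsPath.intervalIntegrable_s_sq :
    IntervalIntegrable (fun t => ‖S.s (y t)‖ ^ 2) volume 0 T :=
  ((S.continuous_s.comp hp.continuous).norm.pow 2).intervalIntegrable 0 T

theorem IsPath.intervalIntegrable_sq_sub :
    IntervalIntegrable (fun t => ‖S.s (y t) - α t‖ ^ 2) volume 0 T := by
  have : (fun t => ‖S.s (y t) - α t‖ ^ 2) =
      fun t => ‖S.s (y t)‖ ^ 2 - S.reward (y t) (α t) := by
    ext t
    have := S.reward_s_sub (y t) (S.s (y t) - α t)
    rw [sub_sub_cancel] at this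
    linarith
  rw [this]
  exact (hp.intervalIntegrable_s_sq hT).sub (hp.intervalIntegrable_reward le_rfl hT)

theorem IsPath.integral_reward :
    ∫ t in (0 : ℝ)..T, S.reward (y t) (α t) = (∫ t in (0 : ℝ)..T, ‖S.s (y t)‖ ^ 2) -
      ∫ t in (0 : ℝ)..T, ‖S.s (y t) - α t‖ ^ 2 := by
  rw [← intervalIntegral.integral_sub (hp.intervalIntegrable_s_sq hT)
    (hp.intervalIntegrable_sq_sub hT)]
  congr 1
  ext t
  have := S.reward_s_sub (y t) (S.s (y t) - α t)
  rwa [sub_sub_cancel] at this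

end

section

variable {y₀ : E} {α β : ℝ → G} {y : ℝ → E} [MeasurableSpace G] [BorelSpace G] {c K δ : ℝ}
  (hδ : 0 < δ) (hβ : Measurable β) (hK : 0 ≤ K) (hc0 : 0 ≤ c)
include hδ hβ hK hc0

/-- The control cost is kept on the right, so that only nonnegative integrals are averaged and `∞ -
∞` cannot occur. -/
theorem IsPath.lintegral_le (hp : S.IsPath y₀ (fun t => S.s (y t) - β t) y)
    (hc : ∀ T, 0 ≤ T → ∫ t in (0 : ℝ)..T, S.reward (y t) (S.s (y t) - β t) ≤ c * T + K) :
    ∫⁻ t in Ioi (0 : ℝ), ENNReal.ofReal (‖S.s (y t)‖ ^ 2) * ENNReal.ofReal (Real.exp (-δ * t)) ≤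
      (∫⁻ t in Ioi (0 : ℝ), ENNReal.ofReal (‖β t‖ ^ 2) * ENNReal.ofReal (Real.exp (-δ * t))) +
        ENNReal.ofReal (c / δ + K) := by
  rw [ENNReal.ofReal_add (by positivity) hK, ← add_assoc, ← lintegral_add_const_mul_exp hδ hc0]
  have hs : Measurable fun t => S.s (y t) := (S.continuous_s.comp hp.continuous).measurable
  refine lintegral_mul_exp_le hδ (by fun_prop) (by fun_prop) fun T hT => ?_
  have h1 := hc T hT.le
  have i1 := hp.intervalIntegrable_sq_sub hT.le
  have e1 := hp.integral_reward hT.le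
  simp only [sub_sub_cancel] at i1 e1
  rw [lintegral_add_right _ measurable_const, lintegral_const, lintegral_Ioo_ofReal_eq
    (fun _ => sq_nonneg _) hT.le (hp.intervalIntegrable_s_sq hT.le), lintegral_Ioo_ofReal_eq
    (fun _ => sq_nonneg _) hT.le i1]
  have j1 : 0 ≤ ∫ t in (0 : ℝ)..T, ‖β t‖ ^ 2 :=
    intervalIntegral.integral_nonneg hT.le fun _ _ => sq_nonneg _
  rw [Measure.restrict_apply_univ, Real.volume_Ioo, sub_zero, ← ENNReal.ofReal_mul hc0,
    ← ENNReal.ofReal_add j1 (by positivity), ← ENNReal.ofReal_add (by positivity) hK]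
  exact ENNReal.ofReal_le_ofReal (by linarith)

theorem IsPath.le_lintegral {η : ℝ} (hη : 0 ≤ η)
    (hp : S.IsPath y₀ (fun t => S.s (y t) - β t) y)
    (hc : ∀ T, 0 ≤ T → (c - η) * T - K ≤
      ∫ t in (0 : ℝ)..T, S.reward (y t) (S.s (y t) - β t)) :
    (∫⁻ t in Ioi (0 : ℝ), ENNReal.ofReal (‖β t‖ ^ 2) * ENNReal.ofReal (Real.exp (-δ * t))) +
        ENNReal.ofReal (c / δ) ≤
      (∫⁻ t in Ioi (0 : ℝ), ENNReal.ofReal (‖S.s (y t)‖ ^ 2) *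
        ENNReal.ofReal (Real.exp (-δ * t))) + ENNReal.ofReal (η / δ + K) := by
  rw [ENNReal.ofReal_add (by positivity) hK, ← add_assoc, ← lintegral_add_const_mul_exp hδ hc0,
    ← lintegral_add_const_mul_exp hδ hη]
  have hs : Measurable fun t => S.s (y t) := (S.continuous_s.comp hp.continuous).measurable
  refine lintegral_mul_exp_le hδ (by fun_prop) (by fun_prop) fun T hT => ?_
  have h1 := hc T hT.le
  have i1 := hp.intervalIntegrable_sq_sub hT.le
  have e1 := hp.integral_reward hT.le
  simp only [sub_sub_cancel] at i1 e1
  rw [lintegral_add_right _ measurable_const, lintegral_add_right _ measurable_const,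
    lintegral_const, lintegral_const, lintegral_Ioo_ofReal_eq
    (fun _ => sq_nonneg _) hT.le (hp.intervalIntegrable_s_sq hT.le), lintegral_Ioo_ofReal_eq
    (fun _ => sq_nonneg _) hT.le i1]
  have j1 : 0 ≤ ∫ t in (0 : ℝ)..T, ‖β t‖ ^ 2 :=
    intervalIntegral.integral_nonneg hT.le fun _ _ => sq_nonneg _
  have j2 : 0 ≤ ∫ t in (0 : ℝ)..T, ‖S.s (y t)‖ ^ 2 :=
    intervalIntegral.integral_nonneg hT.le fun _ _ => sq_nonneg _
  rw [Measure.restrict_apply_univ, Real.volume_Ioo, sub_zero, ← ENNReal.ofReal_mul hc0,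
    ← ENNReal.ofReal_mul hη, ← ENNReal.ofReal_add j1 (by positivity),
    ← ENNReal.ofReal_add j2 (by positivity), ← ENNReal.ofReal_add (by positivity) hK]
  exact ENNReal.ofReal_le_ofReal (by linarith)

end

theorem lintegral_s_sq_ne_top {δ : ℝ} (hδ : 0 < δ) (y : ℝ → E) :
    ∫⁻ t in Ioi (0 : ℝ), ENNReal.ofReal (‖S.s (y t)‖ ^ 2) *
      ENNReal.ofReal (Real.exp (-δ * t)) ≠ ⊤ := by
  have h := lintegral_add_const_mul_exp hδ (g := fun _ => 0) (sq_nonneg S.M)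
  simp only [zero_add, zero_mul, lintegral_zero] at h
  refine ne_top_of_le_ne_top (b := ENNReal.ofReal (S.M ^ 2 / δ)) (by simp) ?_
  rw [← h]
  refine lintegral_mono fun t => ?_
  gcongr
  exact S.norm_s_le _

end PeriodicSystem

/-- On `[a, b]` the weight is at least `e^{-δb}`, so a finite discounted cost forces the local
square integrability required by `IsPath`. -/
theorem intervalIntegrable_sq_of_lintegral_mul_exp_ne_top {G : Type*} [NormedAddCommGroup G]
    [MeasurableSpace G] [BorelSpace G] {β : ℝ → G} (hβ : Measurable β) {δ : ℝ} (hδ : 0 < δ)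
    (h : ∫⁻ t in Ioi (0 : ℝ), ENNReal.ofReal (‖β t‖ ^ 2) * ENNReal.ofReal (Real.exp (-δ * t)) ≠ ⊤)
    {a b : ℝ} (ha : 0 ≤ a) (hab : a ≤ b) :
    IntervalIntegrable (fun t => ‖β t‖ ^ 2) volume a b := by
  rw [intervalIntegrable_iff_integrableOn_Ioc_of_le hab]
  have hm : Measurable fun t => ‖β t‖ ^ 2 := by fun_prop
  refine ⟨hm.aestronglyMeasurable, ?_⟩
  rw [hasFiniteIntegral_iff_ofReal (Eventually.of_forall fun _ => sq_nonneg _)]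
  have h1 : ∫⁻ t in Ioc a b, ENNReal.ofReal (‖β t‖ ^ 2) ≤ ENNReal.ofReal (Real.exp (δ * b)) *
      ∫⁻ t in Ioi (0 : ℝ), ENNReal.ofReal (‖β t‖ ^ 2) * ENNReal.ofReal (Real.exp (-δ * t)) := by
    rw [← lintegral_const_mul _ (by fun_prop)]
    refine (setLIntegral_mono' measurableSet_Ioc fun t ht => ?_).trans
      (lintegral_mono_set (fun t ht => ha.trans_lt ht.1))
    rw [mul_left_comm, ← ENNReal.ofReal_mul (by positivity), ← Real.exp_add]
    refine le_mul_of_one_le_right' ?_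
    rw [ENNReal.one_le_ofReal, Real.one_le_exp_iff]
    nlinarith [ht.2]
  exact h1.trans_lt (ENNReal.mul_lt_top ENNReal.ofReal_lt_top h.lt_top)

namespace PeriodicSystem

variable {E G : Type*} [NormedAddCommGroup E] [InnerProductSpace ℝ E] [FiniteDimensional ℝ E]
    [NormedAddCommGroup G] [InnerProductSpace ℝ G] [FiniteDimensional ℝ G]
    [MeasurableSpace G] [BorelSpace G] {S : PeriodicSystem E G}

/-- Carathéodory trajectories for the control `β = s - α`. -/
def IsCaratheodory (S : PeriodicSystem E G) (y₀ : E) (β : ℝ → G) (y : ℝ → E) : Prop :=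
  ∀ t : ℝ, 0 ≤ t →
    IntervalIntegrable (fun r => (2 : ℝ) • S.A (y r) (S.s (y r)) - (2 : ℝ) • S.A (y r) (β r))
      volume 0 t ∧
    y t = y₀ + ∫ r in (0 : ℝ)..t,
      ((2 : ℝ) • S.A (y r) (S.s (y r)) - (2 : ℝ) • S.A (y r) (β r))

theorem IsCaratheodory.continuousOn {y₀ : E} {β : ℝ → G} {y : ℝ → E}
    (h : S.IsCaratheodory y₀ β y) : ContinuousOn y (Ici 0) := by
  intro t ht
  have ht' : (0 : ℝ) ≤ t + 1 := by linarith [mem_Ici.1 ht]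
  have h1 : ContinuousOn y (Icc 0 (t + 1)) := by
    have h2 := intervalIntegral.continuousOn_primitive_interval
      ((intervalIntegrable_iff_integrableOn_Icc_of_le ht').1 (h (t + 1) ht').1 |>.mono_set
        (uIcc_of_le ht').le)
    rw [uIcc_of_le ht'] at h2
    exact (continuousOn_const.add h2).congr fun r hr => (h r hr.1).2
  refine (h1 t ⟨ht, by linarith⟩).mono_of_mem_nhdsWithin ?_
  rw [← Ici_inter_Iic]
  exact inter_mem_nhdsWithin _ (Iic_mem_nhds (by linarith))

/-- A trajectory is constrained only for `t ≥ 0`. Freezing it at its initial point for negative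
times makes it continuous on the whole line. -/
theorem IsCaratheodory.isPath {y₀ : E} {β : ℝ → G} {y : ℝ → E}
    (h : S.IsCaratheodory y₀ β y) (hβ : Measurable β)
    (hβ2 : ∀ a b, 0 ≤ a → a ≤ b → IntervalIntegrable (fun t => ‖β t‖ ^ 2) volume a b) :
    S.IsPath y₀ (fun t => S.s (y (max t 0)) - β t) (fun t => y (max t 0)) := by
  have hc : Continuous fun t => y (max t 0) :=
    h.continuousOn.comp_continuous (by fun_prop) fun t => mem_Ici.2 (le_max_right _ _)
  have hs := S.continuous_s.comp hc
  have hm : AEStronglyMeasurable (fun t => S.s (y (max t 0)) - β t) volume :=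
    hs.aestronglyMeasurable.sub hβ.aestronglyMeasurable
  refine ⟨hc, hm, fun a b ha hab => ?_, fun t ht => ?_⟩
  · refine ((intervalIntegrable_const (c := 2 * S.M ^ 2)).add
      ((hβ2 a b ha hab).const_mul 2)).mono_fun (hm.norm.pow 2).restrict
      (Eventually.of_forall fun t => ?_)
    refine le_trans ?_ (le_abs_self _)
    change ‖‖S.s (y (max t 0)) - β t‖ ^ 2‖ ≤ 2 * S.M ^ 2 + 2 * ‖β t‖ ^ 2
    rw [Real.norm_of_nonneg (sq_nonneg _)]
    have h1 : ‖S.s (y (max t 0)) - β t‖ ≤ S.M + ‖β t‖ :=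
      (norm_sub_le _ _).trans (by gcongr; exact S.norm_s_le _)
    have h2 : ‖S.s (y (max t 0)) - β t‖ ^ 2 ≤ (S.M + ‖β t‖) ^ 2 := by gcongr
    nlinarith [sq_nonneg (S.M - ‖β t‖)]
  · rw [max_eq_left ht, (h t ht).2]
    congr 1
    refine intervalIntegral.integral_congr fun r hr => ?_
    rw [uIcc_of_le ht] at hr
    simp only [max_eq_left hr.1, map_sub, smul_sub]

theorem IsPath.isCaratheodory {y₀ : E} {α : ℝ → G} {y : ℝ → E} (hp : S.IsPath y₀ α y) :
    S.IsCaratheodory y₀ (fun t => S.s (y t) - α t) y := by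
  have e : (fun r => (2 : ℝ) • S.A (y r) (S.s (y r)) -
      (2 : ℝ) • S.A (y r) (S.s (y r) - α r)) = fun r => (2 : ℝ) • S.A (y r) (α r) := by
    ext1 r
    rw [← smul_sub, ← map_sub, sub_sub_cancel]
  intro t ht
  rw [e]
  exact ⟨(hp.intervalIntegrable_A le_rfl ht).smul 2, hp.eq t ht⟩

theorem IsCaratheodory.payoff_le {c : ℝ} (hc0 : 0 ≤ c)
    (hc : ∀ ε > 0, ∃ h, 0 < h ∧ h ≤ 1 ∧ h ≤ ε ∧ ∃ c₁ w₁, |c₁ - c| ≤ ε ∧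
      S.IsSchemeSolution h S.schemeBound c₁ w₁) {δ : ℝ} (hδ : 0 < δ)
    {y₀ : E} {β : ℝ → G} {y : ℝ → E} (h : S.IsCaratheodory y₀ β y) (hβ : Measurable β) :
    (δ : EReal) * (((∫⁻ t in Ioi (0 : ℝ),
        ENNReal.ofReal (‖S.s (y t)‖ ^ 2 * Real.exp (-δ * t)) : ENNReal) : EReal)
      - ((∫⁻ t in Ioi (0 : ℝ),
        ENNReal.ofReal (‖β t‖ ^ 2 * Real.exp (-δ * t)) : ENNReal) : EReal)) ≤
      ((c + 2 * S.schemeBound * δ : ℝ) : EReal) := by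
  have hK : 0 ≤ 2 * S.schemeBound := by linarith [S.one_le_schemeBound]
  have e : c + 2 * S.schemeBound * δ = δ * (c / δ + 2 * S.schemeBound) := by field_simp
  rw [e]
  refine EReal.mul_sub_le_of_le_add hδ (by positivity) ?_
  simp only [ENNReal.ofReal_mul (sq_nonneg _)]
  -- Controls of infinite discounted cost satisfy the bound trivially. All others are locally square
  -- integrable, so the verification argument applies.
  by_cases hfin : ∫⁻ t in Ioi (0 : ℝ),
      ENNReal.ofReal (‖β t‖ ^ 2) * ENNReal.ofReal (Real.exp (-δ * t)) = ⊤
  · rw [hfin, top_add]; exact le_top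
  have hp := h.isPath hβ fun a b ha hab =>
    intervalIntegrable_sq_of_lintegral_mul_exp_ne_top hβ hδ hfin ha hab
  have e2 : ∫⁻ t in Ioi (0 : ℝ), ENNReal.ofReal (‖S.s (y t)‖ ^ 2) *
      ENNReal.ofReal (Real.exp (-δ * t)) = ∫⁻ t in Ioi (0 : ℝ),
      ENNReal.ofReal (‖S.s (y (max t 0))‖ ^ 2) * ENNReal.ofReal (Real.exp (-δ * t)) :=
    setLIntegral_congr_fun measurableSet_Ioi fun t ht => by
      simp only [max_eq_left (le_of_lt (mem_Ioi.1 ht))]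
  rw [e2]
  exact hp.lintegral_le hδ hβ hK hc0 fun T hT => hp.integral_reward_le hc hT

variable (S) in
theorem exists_isCaratheodory_le_payoff {c : ℝ} (hc0 : 0 ≤ c)
    (hc : ∀ ε > 0, ∃ h, 0 < h ∧ h ≤ 1 ∧ h ≤ ε ∧ ∃ c₁ w₁, |c₁ - c| ≤ ε ∧
      S.IsSchemeSolution h S.schemeBound c₁ w₁) :
    ∃ K', ∀ η > 0, ∀ δ > 0, ∀ y₀, ∃ β y, Measurable β ∧ S.IsCaratheodory y₀ β y ∧
    ((c - η - K' * δ : ℝ) : EReal) ≤ (δ : EReal) * (((∫⁻ t in Ioi (0 : ℝ),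
        ENNReal.ofReal (‖S.s (y t)‖ ^ 2 * Real.exp (-δ * t)) : ENNReal) : EReal)
      - ((∫⁻ t in Ioi (0 : ℝ),
        ENNReal.ofReal (‖β t‖ ^ 2 * Real.exp (-δ * t)) : ENNReal) : EReal)) := by
  obtain ⟨K', hK'⟩ := S.exists_isPath_le_integral_reward hc
  -- The constant must be nonnegative to survive `ENNReal.ofReal`.
  refine ⟨max K' 0, fun η hη δ hδ y₀ => ?_⟩
  obtain ⟨α, y, hp, hα, hr⟩ := hK' η hη y₀
  have hβ : Measurable fun t => S.s (y t) - α t :=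
    (S.continuous_s.comp hp.continuous).measurable.sub hα.measurable
  refine ⟨fun t => S.s (y t) - α t, y, hβ, hp.isCaratheodory, ?_⟩
  have e : c - η - max K' 0 * δ = δ * (c / δ - (η / δ + max K' 0)) := by field_simp; ring
  rw [e]
  have hp' : S.IsPath y₀ (fun t => S.s (y t) - (S.s (y t) - α t)) y := by
    simpa only [sub_sub_cancel] using hp
  have hmax : 0 ≤ max K' 0 := le_max_right _ _
  refine EReal.le_mul_sub_of_add_le hδ (by positivity) (by positivity) ?_ ?_
  · simp only [ENNReal.ofReal_mul (sq_nonneg _)]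
    exact lintegral_s_sq_ne_top hδ y
  · simp only [ENNReal.ofReal_mul (sq_nonneg _)]
    refine hp'.le_lintegral hδ hβ hmax hc0 hη.le fun T hT => ?_
    simp only [sub_sub_cancel]
    linarith [hr T hT, le_max_left K' 0]

end PeriodicSystem

/-! ### Uniform bounds from periodicity, and right inverses -/

section Periodic

variable {E F : Type*} [NormedAddCommGroup E] [NormedSpace ℝ E] [ProperSpace E]
  [NormedAddCommGroup F] {P : AddSubgroup E} {D : ℝ} (hcov : ∀ y : E, ∃ k ∈ P, ‖y + k‖ ≤ D)
  {f : E → F} (hp : ∀ y, ∀ k ∈ P, f (y + k) = f y)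
include hcov hp

theorem exists_norm_le_of_continuous_of_periodic (hf : Continuous f) : ∃ C, ∀ y, ‖f y‖ ≤ C := by
  obtain ⟨C, hC⟩ := (isCompact_closedBall (0 : E) D).exists_bound_of_continuousOn hf.continuousOn
  refine ⟨C, fun y => ?_⟩
  obtain ⟨k, hk, hkD⟩ := hcov y
  rw [← hp y k hk]
  exact hC _ (by simpa using hkD)

/-- A common period moves two points at distance at most one into a fixed compact ball, where a
single Lipschitz constant works. For distant points boundedness is enough. -/
theorem exists_lipschitz_of_locallyLipschitz_of_periodic (hf : LocallyLipschitz f) :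
    ∃ C, 0 ≤ C ∧ ∀ x y, ‖f x - f y‖ ≤ C * ‖x - y‖ := by
  obtain ⟨B, hB⟩ := exists_norm_le_of_continuous_of_periodic hcov hp hf.continuous
  have hB0 : 0 ≤ B := (norm_nonneg _).trans (hB 0)
  obtain ⟨K, hK⟩ := (hf.locallyLipschitzOn (s := Metric.closedBall (0 : E) (D + 1)))
    |>.exists_lipschitzOnWith_of_compact (isCompact_closedBall _ _)
  refine ⟨K + 2 * B, by positivity, fun x y => ?_⟩
  rw [add_mul]
  by_cases hxy : ‖x - y‖ ≤ 1
  · obtain ⟨k, hk, hkD⟩ := hcov x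
    have h1 : y + k ∈ Metric.closedBall (0 : E) (D + 1) := by
      rw [mem_closedBall_zero_iff]
      have : y + k = (x + k) - (x - y) := by abel
      rw [this]
      exact (norm_sub_le _ _).trans (by linarith)
    have h2 : x + k ∈ Metric.closedBall (0 : E) (D + 1) := by
      rw [mem_closedBall_zero_iff]; linarith
    have h3 := hK.dist_le_mul _ h2 _ h1
    rw [hp x k hk, hp y k hk, dist_eq_norm, dist_eq_norm, add_sub_add_right_eq_sub] at h3
    have : 0 ≤ 2 * B * ‖x - y‖ := by positivity
    linarith
  · have h1 := norm_sub_le (f x) (f y)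
    have h2 := hB x
    have h3 := hB y
    have h4 : 0 ≤ (K : ℝ) * ‖x - y‖ := by positivity
    have h5 : 2 * B * 1 ≤ 2 * B * ‖x - y‖ := by gcongr; linarith
    linarith

end Periodic

section RightInverse

variable {E G : Type*} [NormedAddCommGroup E] [InnerProductSpace ℝ E] [FiniteDimensional ℝ E]
    [NormedAddCommGroup G] [InnerProductSpace ℝ G] [FiniteDimensional ℝ G]

/-- The Moore-Penrose right inverse of a surjective map. -/
noncomputable def rightInv (A : G →L[ℝ] E) : E →L[ℝ] G :=
  (ContinuousLinearMap.adjoint A).comp (Ring.inverse (A.comp (ContinuousLinearMap.adjoint A)))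

/-- The kernel of `AAᵀ` is that of `Aᵀ`, which the lower bound makes trivial. In finite dimension
injectivity gives bijectivity. -/
theorem isUnit_comp_adjoint {A : G →L[ℝ] E} {θ : ℝ} (hθ : 0 < θ)
    (h : ∀ ξ, θ * ‖ξ‖ ^ 2 ≤ ‖ContinuousLinearMap.adjoint A ξ‖ ^ 2) :
    IsUnit (A.comp (ContinuousLinearMap.adjoint A)) := by
  rw [ContinuousLinearMap.isUnit_iff_bijective]
  have hinj : Function.Injective (A.comp (ContinuousLinearMap.adjoint A)) := by
    rw [injective_iff_map_eq_zero]
    intro ξ hξ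
    have h1 : ‖ContinuousLinearMap.adjoint A ξ‖ ^ 2 = 0 := by
      rw [← real_inner_self_eq_norm_sq, ContinuousLinearMap.adjoint_inner_left]
      have : A (ContinuousLinearMap.adjoint A ξ) = 0 := hξ
      rw [this, inner_zero_right]
    have h2 := h ξ
    rw [h1] at h2
    have h3 : ‖ξ‖ ^ 2 ≤ 0 := by
      by_contra! hcon
      linarith [mul_pos hθ hcon]
    exact norm_eq_zero.1 (pow_eq_zero_iff two_ne_zero |>.1 (le_antisymm h3 (sq_nonneg _)))
  exact ⟨hinj, LinearMap.injective_iff_surjective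
    (f := (A.comp (ContinuousLinearMap.adjoint A) : E →ₗ[ℝ] E)).1 hinj⟩

theorem apply_rightInv {A : G →L[ℝ] E} (h : IsUnit (A.comp (ContinuousLinearMap.adjoint A)))
    (v : E) : A (rightInv A v) = v := by
  have := Ring.mul_inverse_cancel _ h
  exact DFunLike.congr_fun this v

/-- Inversion is continuous at invertible operators. With periodicity this bounds the right inverses
uniformly. -/
theorem continuous_rightInv_comp {X : Type*} [TopologicalSpace X] {A : X → G →L[ℝ] E}
    (hA : Continuous A)
    (h : ∀ x, IsUnit ((A x).comp (ContinuousLinearMap.adjoint (A x)))) :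
    Continuous fun x => rightInv (A x) := by
  have h3 : Continuous fun y => ContinuousLinearMap.adjoint (A y) :=
    (ContinuousLinearMap.adjoint : (G →L[ℝ] E) ≃ₗᵢ⋆[ℝ] (E →L[ℝ] G)).continuous.comp hA
  have h4 : Continuous fun y => (A y).comp (ContinuousLinearMap.adjoint (A y)) := hA.clm_comp h3
  refine h3.clm_comp (continuous_iff_continuousAt.2 fun y => ?_)
  have h5 := NormedRing.inverse_continuousAt (h y).unit
  exact ContinuousAt.comp (g := Ring.inverse) h5 h4.continuousAt

/-- Assembling a periodic system from periodic Lipschitz data. -/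
theorem exists_periodicSystem {P : AddSubgroup E} {D : ℝ}
    (hcov : ∀ y : E, ∃ k ∈ P, ‖y + k‖ ≤ D) {A : E → G →L[ℝ] E} {s : E → G}
    (hA : LocallyLipschitz A) (hs : LocallyLipschitz s)
    (hAp : ∀ y, ∀ k ∈ P, A (y + k) = A y) (hsp : ∀ y, ∀ k ∈ P, s (y + k) = s y)
    {θ : ℝ} (hθ : 0 < θ)
    (h : ∀ y ξ, θ * ‖ξ‖ ^ 2 ≤ ‖ContinuousLinearMap.adjoint (A y) ξ‖ ^ 2) :
    ∃ S : PeriodicSystem E G, S.A = A ∧ S.s = s ∧ S.P = P := by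
  have hu := fun y => isUnit_comp_adjoint hθ (h y)
  have hR := continuous_rightInv_comp hA.continuous hu
  obtain ⟨C₁, h₁⟩ := exists_norm_le_of_continuous_of_periodic hcov hAp hA.continuous
  obtain ⟨C₂, h₂⟩ := exists_norm_le_of_continuous_of_periodic hcov hsp hs.continuous
  obtain ⟨C₃, h₃⟩ := exists_norm_le_of_continuous_of_periodic hcov
    (f := fun y => rightInv (A y)) (fun y k hk => by simp only [hAp y k hk]) hR
  obtain ⟨C₄, h₄0, h₄⟩ := exists_lipschitz_of_locallyLipschitz_of_periodic hcov hAp hA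
  obtain ⟨C₅, h₅0, h₅⟩ := exists_lipschitz_of_locallyLipschitz_of_periodic hcov hsp hs
  have g₁ : 0 ≤ C₁ := (norm_nonneg _).trans (h₁ 0)
  have g₂ : 0 ≤ C₂ := (norm_nonneg _).trans (h₂ 0)
  have g₃ : 0 ≤ C₃ := (norm_nonneg _).trans (h₃ 0)
  have g₄ : 0 ≤ D := by
    obtain ⟨k, -, hk⟩ := hcov 0
    exact (norm_nonneg _).trans hk
  refine ⟨⟨A, s, fun y => rightInv (A y), P, 1 + C₁ + C₂ + C₃ + C₄ + C₅ + D, by linarith,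
    fun y => (h₁ y).trans (by linarith), fun y => (h₂ y).trans (by linarith),
    fun y => (h₃ y).trans (by linarith),
    fun x y => (h₄ x y).trans (mul_le_mul_of_nonneg_right (by linarith) (norm_nonneg _)),
    fun x y => (h₅ x y).trans (mul_le_mul_of_nonneg_right (by linarith) (norm_nonneg _)),
    hR, fun y v => apply_rightInv (hu y) v, hAp, hsp, fun y => ?_⟩, rfl, rfl, rfl⟩
  obtain ⟨k, hk, hkD⟩ := hcov y
  exact ⟨k, hk, hkD.trans (by linarith)⟩

end RightInverse

/-! ### Matrices, the integer lattice and the frozen system -/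

/-- Matrices as continuous linear maps between Euclidean spaces. -/
noncomputable def matCLM (k l : ℕ) : (Fin k → Fin l → ℝ) →L[ℝ] (Eucl l →L[ℝ] Eucl k) :=
  LinearMap.toContinuousLinearMap
    ((LinearMap.toContinuousLinearMap : (Eucl l →ₗ[ℝ] Eucl k) ≃ₗ[ℝ] _).toLinearMap ∘ₗ
      (Matrix.toEuclideanLin (𝕜 := ℝ) (m := Fin k) (n := Fin l)).toLinearMap ∘ₗ
      (Matrix.ofLinearEquiv ℝ).toLinearMap)

theorem matCLM_apply {k l : ℕ} (A : Matrix (Fin k) (Fin l) ℝ) (ξ : Eucl l) :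
    matCLM k l A ξ = matAct A ξ := rfl

theorem inner_matAct {k l : ℕ} (A : Matrix (Fin k) (Fin l) ℝ) (ξ : Eucl l) (η : Eucl k) :
    inner ℝ (matAct Aᵀ η) ξ = inner ℝ η (matAct A ξ) := by
  simp only [matAct, EuclideanSpace.inner_eq_star_dotProduct, star_trivial]
  rw [Matrix.mulVec_transpose, dotProduct_comm, ← Matrix.dotProduct_mulVec, dotProduct_comm]

theorem adjoint_matCLM {k l : ℕ} (A : Matrix (Fin k) (Fin l) ℝ) :
    ContinuousLinearMap.adjoint (matCLM k l A) = matCLM l k Aᵀ := by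
  symm
  rw [ContinuousLinearMap.eq_adjoint_iff]
  intro x y
  rw [matCLM_apply, matCLM_apply, inner_matAct]

/-- The lattice `ℤᵐ`. -/
def intLattice (m : ℕ) : AddSubgroup (Eucl m) where
  carrier := range fun k : Fin m → ℤ => WithLp.toLp 2 fun j => (k j : ℝ)
  add_mem' := by
    rintro _ _ ⟨k, rfl⟩ ⟨l, rfl⟩
    exact ⟨k + l, by ext j; simp⟩
  zero_mem' := ⟨0, by ext j; simp⟩
  neg_mem' := by
    rintro _ ⟨k, rfl⟩
    exact ⟨-k, by ext j; simp⟩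

theorem zPeriodic_iff {m : ℕ} {α : Type*} {f : Eucl m → α} :
    ZPeriodic f ↔ ∀ y, ∀ k ∈ intLattice m, f (y + k) = f y :=
  ⟨fun h y _ ⟨k, hk⟩ => hk ▸ h y k, fun h y k => h y _ ⟨k, rfl⟩⟩

theorem exists_intLattice_norm_add_le {m : ℕ} (y : Eucl m) :
    ∃ k ∈ intLattice m, ‖y + k‖ ≤ Real.sqrt m := by
  refine ⟨_, ⟨fun j => -⌊y j⌋, rfl⟩, ?_⟩
  rw [EuclideanSpace.norm_eq]
  refine Real.sqrt_le_sqrt ?_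
  calc _ ≤ ∑ _j : Fin m, (1 : ℝ) := by
        refine Finset.sum_le_sum fun j _ => ?_
        have e : (y + WithLp.toLp 2 fun j => ((-⌊y j⌋ : ℤ) : ℝ)) j = Int.fract (y j) := by
          simp [Int.fract, sub_eq_add_neg]
        rw [e, Real.norm_of_nonneg (Int.fract_nonneg _)]
        have h1 := Int.fract_nonneg (y j)
        have h2 := (Int.fract_lt_one (y j)).le
        nlinarith
    _ = m := by simp

theorem locallyLipschitz_pi {X ι : Type*} [PseudoEMetricSpace X] [Fintype ι] {F : ι → Type*}
    [∀ i, PseudoEMetricSpace (F i)] {f : X → ∀ i, F i}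
    (h : ∀ i, LocallyLipschitz fun x => f x i) : LocallyLipschitz f := by
  intro x
  choose K t ht hK using fun i => h i x
  refine ⟨∑ i, K i, ⋂ i, t i, Filter.iInter_mem.2 ht, ?_⟩
  intro a ha b hb
  rw [edist_pi_le_iff]
  intro i
  refine (hK i (mem_iInter.1 ha i) (mem_iInter.1 hb i)).trans ?_
  gcongr
  exact Finset.single_le_sum (f := K) (fun _ _ => zero_le) (Finset.mem_univ i)

section Frozen

variable {n m r : ℕ} {σ : Eucl n → Eucl m → Matrix (Fin n) (Fin r) ℝ}
    {τ : Eucl m → Matrix (Fin m) (Fin r) ℝ}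

theorem exists_periodicSystem_of_matrix
    (hσ_lip : ∃ K : NNReal, ∀ i k,
      LipschitzWith K (fun z : Eucl n × Eucl m => σ z.1 z.2 i k))
    (hσ_per : ∀ x, ZPeriodic (σ x))
    (hτ_lip : ∀ j k, LocallyLipschitz (fun y => τ y j k))
    (hτ_per : ZPeriodic τ)
    (hτ_nondeg : ∃ θ : ℝ, 0 < θ ∧ ∀ (y ξ : Eucl m), θ * ‖ξ‖ ^ 2 ≤ ‖matAct (τ y)ᵀ ξ‖ ^ 2)
    (x p : Eucl n) : ∃ S : PeriodicSystem (Eucl m) (Eucl r),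
      (S.A = fun y => matCLM m r (τ y)) ∧ (S.s = fun y => matAct (σ x y)ᵀ p) ∧
      S.P = intLattice m := by
  obtain ⟨θ, hθ, hnd⟩ := hτ_nondeg
  obtain ⟨K, hK⟩ := hσ_lip
  refine exists_periodicSystem (exists_intLattice_norm_add_le (m := m)) ?_ ?_ ?_ ?_ hθ ?_
  · exact (matCLM m r).lipschitz.locallyLipschitz.comp
      (locallyLipschitz_pi fun j => locallyLipschitz_pi fun k => hτ_lip j k)
  · have h1 : LocallyLipschitz fun y : Eucl m => (fun k i => σ x y i k : Fin r → Fin n → ℝ) :=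
      locallyLipschitz_pi fun k => locallyLipschitz_pi fun i =>
        (show LipschitzWith _ ((fun z : Eucl n × Eucl m => σ z.1 z.2 i k) ∘ Prod.mk x) from
          (hK i k).comp (LipschitzWith.prodMk_left x)).locallyLipschitz
    exact (((ContinuousLinearMap.apply ℝ (Eucl r) p).comp
      (matCLM r n)).lipschitz.locallyLipschitz).comp h1
  · intro y k hk
    simp only [zPeriodic_iff.1 hτ_per y k hk]
  · intro y k hk
    simp only [zPeriodic_iff.1 (hσ_per x) y k hk]
  · intro y ξ
    rw [adjoint_matCLM]
    exact hnd y ξ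

variable {x p : Eucl n} {S : PeriodicSystem (Eucl m) (Eucl r)}
  (hA : S.A = fun y => matCLM m r (τ y)) (hs : S.s = fun y => matAct (σ x y)ᵀ p)
  (hP : S.P = intLattice m)

include hA hs in
theorem ham_eq (y q : Eucl m) : S.ham y q =
    2 * inner ℝ (matAct (τ y) (matAct (σ x y)ᵀ p)) q + ‖matAct (τ y)ᵀ q‖ ^ 2 +
      ‖matAct (σ x y)ᵀ p‖ ^ 2 := by
  rw [PeriodicSystem.ham, hA, hs]
  simp only [adjoint_matCLM, matCLM_apply]
  rw [norm_add_sq_real, inner_matAct, real_inner_comm q]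
  ring

include hA hs hP in
theorem cellProblemSolvable_iff (c : ℝ) :
    CellProblemSolvable σ τ x p c ↔ ∃ w, S.IsCellSolution c w := by
  refine exists_congr fun w => ?_
  rw [zPeriodic_iff, ← hP]
  have e : ∀ y q, c - 2 * inner ℝ (matAct (τ y) (matAct (σ x y)ᵀ p)) q
        - ‖matAct (τ y)ᵀ q‖ ^ 2 - ‖matAct (σ x y)ᵀ p‖ ^ 2 = c - S.ham y q := fun y q => by
    rw [ham_eq hA hs]; ring
  simp only [IsViscositySolution, e, sub_nonneg, sub_nonpos]
  exact ⟨fun h => ⟨h.2.1, h.1, h.2.2.1, h.2.2.2⟩, fun h => ⟨h.2, h.1, h.3, h.4⟩⟩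

include hA hs in
theorem isTrajectory_iff (y₀ : Eucl m) (β : ℝ → Eucl r) (y : ℝ → Eucl m) :
    IsTrajectory σ τ x p y₀ β y ↔ S.IsCaratheodory y₀ β y := by
  simp only [IsTrajectory, PeriodicSystem.IsCaratheodory, controlField, hA, hs, matCLM_apply]

end Frozen

/-! ### The scalar case -/

theorem intervalIntegral_one_div_ne_zero {t : ℝ → ℝ} (ht : Continuous t) (h0 : ∀ u, t u ≠ 0) :
    ∫ u in (0 : ℝ)..1, 1 / t u ≠ 0 := by
  have hc : Continuous fun u => 1 / t u := continuous_const.div ht h0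
  intro h
  have hd : ∀ u, HasDerivAt (fun v => ∫ r in (0 : ℝ)..v, 1 / t r) (1 / t u) u := fun u =>
    intervalIntegral.integral_hasDerivAt_right (hc.intervalIntegrable _ _)
      (hc.stronglyMeasurableAtFilter _ _) hc.continuousAt
  -- Rolle's theorem: a vanishing integral would force `1 / t` to vanish somewhere. The sign of `t`
  -- plays no role.
  obtain ⟨u, -, hu⟩ := exists_hasDerivAt_eq_zero one_pos
    (continuous_iff_continuousAt.2 fun u => (hd u).continuousAt).continuousOn
    (by simp only [intervalIntegral.integral_same, h]) fun u _ => hd u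
  exact h0 u (by simpa using hu)

theorem matAct_one_apply (A : Matrix (Fin 1) (Fin 1) ℝ) (ξ : Eucl 1) :
    matAct A ξ = WithLp.toLp 2 fun _ => A 0 0 * ξ 0 := by
  ext j
  simp [matAct, Matrix.mulVec, dotProduct, Subsingleton.elim j 0]

theorem eucl_one_eq (y : Eucl 1) : y = WithLp.toLp 2 fun _ => y 0 := by
  ext j; rw [Subsingleton.elim j 0]

theorem norm_sq_toLp_one (a : ℝ) : ‖(WithLp.toLp 2 fun _ => a : Eucl 1)‖ ^ 2 = a ^ 2 := by
  simp [EuclideanSpace.norm_sq_eq]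

/-- The explicit solution of the cell problem in the scalar case. -/
theorem isCellSolution_one {S : PeriodicSystem (Eucl 1) (Eucl 1)} {t g : ℝ → ℝ}
    (hA : ∀ u (ξ : Eucl 1), S.A (WithLp.toLp 2 fun _ => u) ξ = WithLp.toLp 2 fun _ => t u * ξ 0)
    (hs : ∀ u, S.s (WithLp.toLp 2 fun _ => u) = WithLp.toLp 2 fun _ => g u)
    (hP : S.P = intLattice 1) (ht : Continuous t) (hg : Continuous g)
    (htp : Function.Periodic t 1) (hgp : Function.Periodic g 1) (h0 : ∀ u, t u ≠ 0) :
    ∃ w, S.IsCellSolution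
      (((∫ u in (0 : ℝ)..1, g u / t u) / ∫ u in (0 : ℝ)..1, 1 / t u) ^ 2) w := by
  set I := ∫ u in (0 : ℝ)..1, 1 / t u with hI
  have hI0 : I ≠ 0 := intervalIntegral_one_div_ne_zero ht h0
  -- The equation `(t w' + g)² = c` is solved by making `t w' + g` a constant `a`. This is the value
  -- of `a` for which `w' = (a - g) / t` has mean zero, so that its primitive is periodic.
  set a := (∫ u in (0 : ℝ)..1, g u / t u) / I with ha
  set f : ℝ → ℝ := fun u => (a - g u) / t u with hf
  have hfc : Continuous f := (continuous_const.sub hg).div ht h0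
  have hfp : Function.Periodic f 1 := fun u => by simp only [hf, htp u, hgp u]
  have hf0 : ∫ u in (0 : ℝ)..1, f u = 0 := by
    have e : ∀ u, f u = a * (1 / t u) - g u / t u := fun u => by simp only [hf]; ring
    simp only [e]
    have c1 : Continuous fun u => 1 / t u := continuous_const.div ht h0
    have c2 : Continuous fun u => g u / t u := hg.div ht h0
    rw [intervalIntegral.integral_sub ((c1.intervalIntegrable _ _).const_mul a)
      (c2.intervalIntegrable _ _), intervalIntegral.integral_const_mul, ← hI, ha]
    field_simp
    ring
  have hd : ∀ u, HasDerivAt (fun v => ∫ r in (0 : ℝ)..v, f r) (f u) u := fun u =>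
    intervalIntegral.integral_hasDerivAt_right (hfc.intervalIntegrable _ _)
      (hfc.stronglyMeasurableAtFilter _ _) hfc.continuousAt
  refine ⟨fun y => ∫ r in (0 : ℝ)..(y 0), f r,
    PeriodicSystem.isCellSolution_of_hasGradientAt
      (w' := fun y => WithLp.toLp 2 fun _ => f (y 0)) (fun y => ?_) (fun y k hk => ?_) fun y => ?_⟩
  · rw [hasGradientAt_iff_hasFDerivAt]
    have h1 : HasFDerivAt (fun z : Eucl 1 => z 0) (EuclideanSpace.proj 0 : Eucl 1 →L[ℝ] ℝ) y :=
      (EuclideanSpace.proj 0 : Eucl 1 →L[ℝ] ℝ).hasFDerivAt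
    refine ((hd (y 0)).hasFDerivAt.comp y h1).congr_fderiv ?_
    ext v
    simp [InnerProductSpace.toDual_apply_apply, PiLp.inner_apply]
  · rw [hP] at hk
    obtain ⟨k, rfl⟩ := hk
    have e1 : (y + WithLp.toLp 2 fun j => (k j : ℝ) : Eucl 1) 0 = y 0 + k 0 := by simp
    simp only [e1]
    rw [← intervalIntegral.integral_add_adjacent_intervals (hfc.intervalIntegrable 0 (y 0))
      (hfc.intervalIntegrable _ _)]
    have := hfp.intervalIntegral_add_zsmul_eq (k 0) (y 0)
      (fun _ _ => hfc.intervalIntegrable _ _)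
    rw [hfp.intervalIntegral_add_eq (y 0) 0, zero_add, hf0, smul_zero, zsmul_one] at this
    rw [this, add_zero]
  · have hadj : ContinuousLinearMap.adjoint (S.A y) (WithLp.toLp 2 fun _ => f (y 0)) =
        WithLp.toLp 2 fun _ => t (y 0) * f (y 0) := by
      refine ext_inner_right ℝ fun v => ?_
      rw [ContinuousLinearMap.adjoint_inner_left]
      conv_lhs => rw [eucl_one_eq y, hA]
      simp [PiLp.inner_apply]
      ring
    rw [PeriodicSystem.ham, hadj]
    conv_lhs => rw [eucl_one_eq y, hs]
    have e : (WithLp.toLp 2 fun _ => t (y 0) * f (y 0) : Eucl 1) +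
        (WithLp.toLp 2 fun _ => g (y 0)) = WithLp.toLp 2 fun _ => a := by
      ext j
      have := h0 (y 0)
      simp only [hf, PiLp.add_apply]
      field_simp
      ring
    rw [e, norm_sq_toLp_one]

/-! ### Proof of the proposition -/

theorem mainTheorem10 {n m r : ℕ}
    (σ : Eucl n → Eucl m → Matrix (Fin n) (Fin r) ℝ)
    (τ : Eucl m → Matrix (Fin m) (Fin r) ℝ)
    (hσ_bdd : ∃ C : ℝ, ∀ x y i k, |σ x y i k| ≤ C)
    (hσ_lip : ∃ K : NNReal, ∀ i k,
      LipschitzWith K (fun z : Eucl n × Eucl m => σ z.1 z.2 i k))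
    (hσ_per : ∀ x, ZPeriodic (σ x))
    (hτ_lip : ∀ j k, LocallyLipschitz (fun y => τ y j k))
    (hτ_per : ZPeriodic τ)
    (hτ_nondeg : ∃ θ : ℝ, 0 < θ ∧ ∀ (y ξ : Eucl m), θ * ‖ξ‖ ^ 2 ≤ ‖matAct (τ y)ᵀ ξ‖ ^ 2) :
    -- the effective Hamiltonian is the one constant for which the cell problem is solvable
    (∀ (x p : Eucl n) (c : ℝ),
      CellProblemSolvable σ τ x p c ↔ c = effectiveHamiltonian σ τ x p) ∧
    -- (i) limit of discounted control values, uniformly in the initial position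
    (∀ x p : Eucl n, ∀ ε : ℝ, 0 < ε → ∀ᶠ δ : ℝ in 𝓝[>] 0, ∀ y₀ : Eucl m,
      ((effectiveHamiltonian σ τ x p - ε : ℝ) : EReal) ≤ discountedValue σ τ x p δ y₀ ∧
      discountedValue σ τ x p δ y₀ ≤ ((effectiveHamiltonian σ τ x p + ε : ℝ) : EReal)) ∧
    -- (ii) the uncorrelated case
    ((∀ (x : Eucl n) (y : Eucl m), τ y * (σ x y)ᵀ = 0) →
      ∀ x p : Eucl n, IsGreatest (range fun y : Eucl m => ‖matAct (σ x y)ᵀ p‖ ^ 2)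
        (effectiveHamiltonian σ τ x p)) ∧
    -- (iii) the scalar case; `i`, `j`, `k` are the only indices
    (n = 1 → m = 1 → r = 1 → ∀ (i : Fin n) (j : Fin m) (k : Fin r),
      (∀ (x : Eucl n) (y : Eucl m), 0 ≤ σ x y i k) →
      ∀ x p : Eucl n, effectiveHamiltonian σ τ x p =
        (∫ s in (0 : ℝ)..1,
            σ x (WithLp.toLp 2 fun _ => s) i k / τ (WithLp.toLp 2 fun _ => s) j k) ^ 2
          * ((∫ s in (0 : ℝ)..1, 1 / τ (WithLp.toLp 2 fun _ => s) j k) ^ 2)⁻¹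
          * (p i) ^ 2) := by
  have hsys := exists_periodicSystem_of_matrix hσ_lip hσ_per hτ_lip hτ_per hτ_nondeg
  have huniq : ∀ (x p : Eucl n) (c : ℝ),
      CellProblemSolvable σ τ x p c ↔ c = effectiveHamiltonian σ τ x p := by
    intro x p c
    obtain ⟨S, hA, hs, hP⟩ := hsys x p
    have hiff := cellProblemSolvable_iff hA hs hP
    obtain ⟨c', w', hw', -⟩ := S.exists_isCellSolution
    -- Since some constant is admissible, the one picked by the choice operator is admissible too,
    -- and uniqueness identifies it.
    have heff : CellProblemSolvable σ τ x p (effectiveHamiltonian σ τ x p) :=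
      Classical.epsilon_spec (p := CellProblemSolvable σ τ x p) ⟨c', (hiff c').2 ⟨w', hw'⟩⟩
    refine ⟨fun h => ?_, fun h => h ▸ heff⟩
    obtain ⟨w₁, hw₁⟩ := (hiff _).1 h
    obtain ⟨w₂, hw₂⟩ := (hiff _).1 heff
    exact hw₁.eq hw₂
  refine ⟨huniq, ?_, ?_, ?_⟩
  · intro x p ε hε
    obtain ⟨S, hA, hs, hP⟩ := hsys x p
    obtain ⟨c, w, hw, hc0, hc⟩ := S.exists_isCellSolution
    rw [← (huniq x p c).1 ((cellProblemSolvable_iff hA hs hP c).2 ⟨w, hw⟩)]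
    obtain ⟨K', hlow⟩ := S.exists_isCaratheodory_le_payoff hc0 hc
    -- The thresholds on `δ` come from constants of the system alone, so the limit is uniform in the
    -- initial position.
    have e1 : ∀ᶠ δ : ℝ in 𝓝[>] 0, 2 * S.schemeBound * δ < ε := by
      have : Tendsto (fun δ : ℝ => 2 * S.schemeBound * δ) (𝓝 0) (𝓝 0) :=
        Continuous.tendsto' (by fun_prop) _ _ (by simp)
      exact (this.eventually_lt_const hε).filter_mono nhdsWithin_le_nhds
    have e2 : ∀ᶠ δ : ℝ in 𝓝[>] 0, K' * δ < ε / 2 := by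
      have : Tendsto (fun δ : ℝ => K' * δ) (𝓝 0) (𝓝 0) :=
        Continuous.tendsto' (by fun_prop) _ _ (by simp)
      exact (this.eventually_lt_const (half_pos hε)).filter_mono nhdsWithin_le_nhds
    filter_upwards [e1, e2, self_mem_nhdsWithin] with δ h1 h2 hδ y₀
    have hsy : ∀ y, matAct (σ x y)ᵀ p = S.s y := fun y => by rw [hs]
    constructor
    · obtain ⟨β, y, hβ, hy, hpay⟩ := hlow (ε / 2) (half_pos hε) δ hδ y₀
      refine le_trans (EReal.coe_le_coe_iff.2 ?_) (hpay.trans ?_)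
      · linarith
      · refine le_iSup_of_le β (le_iSup_of_le y (le_iSup_of_le
          ⟨hβ, (isTrajectory_iff hA hs y₀ β y).2 hy⟩ ?_))
        simp only [discountedPayoff, hsy]
        exact le_rfl
    · refine iSup_le fun β => iSup_le fun y => iSup_le fun hy => ?_
      have hpay := ((isTrajectory_iff hA hs y₀ β y).1 hy.2).payoff_le hc0 hc hδ hy.1
      simp only [discountedPayoff, hsy]
      exact hpay.trans (EReal.coe_le_coe_iff.2 (by linarith))
  · intro hτσ x p
    obtain ⟨S, hA, hs, hP⟩ := hsys x p
    obtain ⟨w, hw⟩ := (cellProblemSolvable_iff hA hs hP _).1 ((huniq x p _).2 rfl)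
    have := hw.isGreatest fun y => by
      rw [hA, hs]
      change matAct (τ y) (matAct (σ x y)ᵀ p) = 0
      rw [matAct, matAct, Matrix.mulVec_mulVec, hτσ, Matrix.zero_mulVec, WithLp.toLp_zero]
    simpa only [hs] using this
  · intro hn hm hr
    subst hn hm hr
    intro i j k _ x p
    rw [Subsingleton.elim i 0, Subsingleton.elim j 0, Subsingleton.elim k 0]
    obtain ⟨S, hA, hs, hP⟩ := hsys x p
    obtain ⟨K, hK⟩ := hσ_lip
    obtain ⟨θ, hθ, hnd⟩ := hτ_nondeg
    have hline : Continuous fun u : ℝ => (WithLp.toLp 2 fun _ => u : Eucl 1) := by fun_prop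
    have hshift : ∀ u : ℝ, (WithLp.toLp 2 fun _ => u + 1 : Eucl 1) =
        (WithLp.toLp 2 fun _ => u) + WithLp.toLp 2 fun _ => (((1 : ℤ) : ℤ) : ℝ) := fun u => by
      ext; simp
    obtain ⟨w, hw⟩ := isCellSolution_one (S := S)
      (t := fun u => τ (WithLp.toLp 2 fun _ => u) 0 0)
      (g := fun u => σ x (WithLp.toLp 2 fun _ => u) 0 0 * p 0)
      (fun u ξ => by rw [hA]; exact matAct_one_apply _ _)
      (fun u => by simp only [hs, matAct_one_apply, Matrix.transpose_apply])
      hP ((hτ_lip 0 0).continuous.comp hline)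
      (((hK 0 0).continuous.comp (continuous_const.prodMk hline)).mul continuous_const)
      (fun u => by simp only [hshift, hτ_per _ fun _ => 1])
      (fun u => by simp only [hshift, hσ_per x _ fun _ => 1])
      -- A zero of `τ` would contradict nondegeneracy at the vector `ξ = 1`.
      (fun u hu => by
        have h1 := hnd (WithLp.toLp 2 fun _ => u) (WithLp.toLp 2 fun _ => 1)
        rw [matAct_one_apply, norm_sq_toLp_one, norm_sq_toLp_one, Matrix.transpose_apply, hu] at h1
        norm_num at h1
        linarith)
    rw [← (huniq x p _).1 ((cellProblemSolvable_iff hA hs hP _).2 ⟨w, hw⟩)]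
    have e : ∀ u : ℝ, σ x (WithLp.toLp 2 fun _ => u) 0 0 * p 0 / τ (WithLp.toLp 2 fun _ => u) 0 0 =
        σ x (WithLp.toLp 2 fun _ => u) 0 0 / τ (WithLp.toLp 2 fun _ => u) 0 0 * p 0 :=
      fun u => by ring
    simp only [e]
    rw [intervalIntegral.integral_mul_const]
    ring
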